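/- **Limits of the mean optimal matching cost (one-dimensional Grid–Poisson problem at criticality).** For an integer $L\ge 1$ let the red points be $r_i=i-\tfrac12$, $i=1,\dots,L$, and let the blue points $b_1,\dots,b_L$ be independent and uniformly distributed on $[0,L]$. For $p>1$ let $$E_{\rm opt}=\min_{\pi}\sum_{i=1}^{L} d(r_i,b_{\pi(i)})^p ,$$ the minimum being over all permutations $\pi$ of $\{1,\dots,L\}$, where $d(x,y)=|y-x|$ for *open boundary conditions* and $d(x,y)=\min_{\nu\in\mathbb Z}|y-x-\nu L|$ for *periodic boundary conditions*. Let $\mathcal E_{\rm opt}(L)=\frac1L\,\mathbb E[E_{\rm opt}]$ be the mean optimal cost per unit length (the expectation exists and is finite in the cases considered below). Let $B$ be a standard Brownian bridge on $[0,1]$, i.e. a centred Gaussian process with covariance $\min(s,t)-st$ and almost surely continuous paths. 1. Open boundary conditions: for every real $p>1$, as $L\to\infty$, $$L^{-p/2}\,\mathcal E_{\rm opt}(L)\;\longrightarrow\;\int_0^1\mathbb E|B(s)|^p\,ds ,$$ where the integral is finite and $$\int_0^1\mathbb E|B(s)|^p\,ds=\int_0^1\frac{[2s(1-s)]^{p/2}}{\sqrt\pi}\,\Gamma\!\left(\tfrac{1+p}{2}\right)ds=\sqrt{\frac{2^p}{\pi}}\,\frac{\Gamma(\frac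 p2+1)^2}{\Gamma(p+2)}\,\Gamma\!\left(\tfrac{1+p}{2}\right)=2^{-p/2}\,\frac{\Gamma(\frac p2+1)}{p+1}.$$ In particular, for $p=2$, $L^{-1}\mathcal E_{\rm opt}(L)\to\int_0^1 s(1-s)\,ds=\frac16$. 2. Periodic boundary conditions, $p=2$: as $L\to\infty$, $L^{-1}\,\mathcal E_{\rm opt}(L)\to\frac1{12}$. -/

import Mathlib

open MeasureTheory ProbabilityTheory Filter Topology

namespace GridPoisson

noncomputable section

/-- The cost of the matching `π` (an injection of the red vertices into the blue ones). -/
def matchingCost {N M : ℕ} (w : Fin N → Fin M → ℝ) (π : Fin N ↪ Fin M) : ℝ :=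
  ∑ i, w i (π i)

/-- The minimum of `matchingCost w` over all maximal matchings, for `N ≤ M`. -/
def optimalCost {N M : ℕ} (w : Fin N → Fin M → ℝ) : ℝ :=
  ⨅ π : Fin N ↪ Fin M, matchingCost w π

/-- The infimum is a minimum as soon as a matching exists. -/
theorem exists_matchingCost_eq_optimalCost {N M : ℕ} (h : N ≤ M) (w : Fin N → Fin M → ℝ) :
    (∃ π, matchingCost w π = optimalCost w) ∧ ∀ π, optimalCost w ≤ matchingCost w π := by
  have : Nonempty (Fin N ↪ Fin M) := ⟨Fin.castLEEmb h⟩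
  exact ⟨exists_eq_ciInf_of_finite, fun π => ciInf_le (Set.finite_range _).bddBelow π⟩

/-- The red points of the box `[0, L]`: `1/2, 3/2, …, L - 1/2`. -/
def redPoint {L : ℕ} (i : Fin L) : ℝ := (i : ℝ) + 1 / 2

/-- The law of `M` independent points, each uniformly distributed on `[0, L]`. -/
def blueLaw (L M : ℕ) : Measure (Fin M → ℝ) :=
  Measure.pi fun _ => ProbabilityTheory.cond volume (Set.Icc (0 : ℝ) L)

/-- The distance on the circle obtained from `[0, L]` by identifying its end points. -/
def periodicDist (L x y : ℝ) : ℝ := ⨅ ν : ℤ, |y - x - ν * L|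

/-- `E_opt` with open boundary conditions, for the blue points `b`. -/
def openOptimalCost (p : ℝ) {L M : ℕ} (b : Fin M → ℝ) : ℝ :=
  optimalCost fun (i : Fin L) (j : Fin M) => |b j - redPoint i| ^ p

/-- `E_opt` with periodic boundary conditions, for the blue points `b`. -/
def periodicOptimalCost (p : ℝ) {L M : ℕ} (b : Fin M → ℝ) : ℝ :=
  optimalCost fun (i : Fin L) (j : Fin M) => periodicDist L (redPoint i) (b j) ^ p

/-- `E_opt` at criticality (`L` red and `L` blue points), open boundary conditions. -/
def criticalOpenCost (p : ℝ) (L : ℕ) (b : Fin L → ℝ) : ℝ :=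
  openOptimalCost p (L := L) b

/-- `E_opt` at criticality (`L` red and `L` blue points), periodic boundary conditions. -/
def criticalPeriodicCost (p : ℝ) (L : ℕ) (b : Fin L → ℝ) : ℝ :=
  periodicOptimalCost p (L := L) b

/-- A standard Brownian bridge over `[0, 1]`: a centred Gaussian process with covariance
`min s t - s t` and almost surely continuous paths. -/
structure IsBrownianBridge {Ω : Type*} [MeasurableSpace Ω] (B : unitInterval → Ω → ℝ)
    (P : Measure Ω) : Prop where
  gaussian : IsGaussianProcess B P
  mean : ∀ t, ∫ ω, B t ω ∂P = 0
  covariance : ∀ s t, ProbabilityTheory.covariance (B s) (B t) P = min (s : ℝ) t - s * t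
  cont : ∀ᵐ ω ∂P, Continuous fun t => B t ω

/-- If `W` is a Brownian motion, then `W t - t W 1` is a Brownian bridge. -/
theorem IsBrownianBridge.of_isBrownianReal {Ω : Type*} [MeasurableSpace Ω]
    {W : NNReal → Ω → ℝ} {P : Measure Ω} (hW : IsBrownianReal W P) :
    IsBrownianBridge (fun t ω => W (unitInterval.toNNReal t) ω - t * W 1 ω) P where
  gaussian := by
    refine hW.isGaussianProcess.of_isGaussianProcess fun t => ?_
    exact ⟨{unitInterval.toNNReal t, 1},
      { toFun := fun x => x ⟨unitInterval.toNNReal t, by simp⟩ - t * x ⟨1, by simp⟩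
        map_add' := fun x y => by simp; ring
        map_smul' := fun c x => by simp; ring }, by simp⟩
  mean t := by
    rw [integral_sub (hW.integrable_eval _) ((hW.integrable_eval _).const_mul _),
      integral_const_mul, hW.integral_eval, hW.integral_eval]
    simp
  covariance s t := by
    have := hW.isGaussianProcess.isProbabilityMeasure
    have m := fun r => (hW.isGaussianProcess.hasGaussianLaw_eval r).memLp_two
    have m' := fun (c : ℝ) => (m 1).const_mul c
    have hs : unitInterval.toNNReal s ≤ 1 := s.2.2
    have ht : unitInterval.toNNReal t ≤ 1 := t.2.2
    have m2 : MemLp (fun ω => W (unitInterval.toNNReal t) ω - (t : ℝ) * W 1 ω) 2 P :=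
      (m _).sub (m' _)
    rw [covariance_fun_sub_left (m _) (m' _) m2,
      covariance_fun_sub_right (m _) (m _) (m' _),
      covariance_fun_sub_right (m' _) (m _) (m' _), covariance_const_mul_left,
      covariance_const_mul_left, covariance_const_mul_right, covariance_const_mul_right,
      hW.covariance_fun_eval, hW.covariance_fun_eval, hW.covariance_fun_eval,
      hW.covariance_fun_eval, min_eq_left hs, min_eq_right ht, min_self]
    simp
    ring
  cont := by
    filter_upwards [hW.cont] with ω h
    have h1 : Continuous unitInterval.toNNReal := by
      unfold unitInterval.toNNReal
      fun_prop
    fun_prop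

end

end GridPoisson

/-! Open boundary conditions. For p ≥ 1 the cost is a convex function of the difference of
positions, so uncrossing two pairs never raises it and the increasing matching is optimal
(`criticalOpenCost_eq`). Replacing each red point by an average over its unit cell turns the cost
into the p-th power distance between the quantile function of the blue points and the identity. In
dimension one that distance is the same for the distribution function
(`integral_abs_sortedBlue_sub`), so the cost is close to ∫ |N(x) - x|^p dx, where N counts the blue
points (`criticalOpenCost_comparison`).

Under x = L s, the difference N(x) - x is √L times the uniform empirical process at s. For each
fixed s the central limit theorem gives a centred Gaussian of variance s(1 - s), which is the law of
the bridge at s. Sub-Gaussian bounds, uniform in L and s, upgrade this to convergence of p-th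
moments (`tendsto_empiricalMoment`) and supply the domination for integrating over s. Only
one-dimensional marginals enter, so no functional limit theorem is needed. The closed form comes
from a Beta integral and the duplication formula.

Periodic boundary conditions, p = 2. With d the displacements of the increasing matching, the cost
lies between V and V + L/4, where V = ∑ d² - (∑ d)²/L. The lower bound is a convex duality argument
(`sum_sq_sub_le_of_quasiPeriodic`, `le_criticalPeriodicCost`); the upper bound rotates the matching
by the integer nearest to the mean displacement (`criticalPeriodicCost_le`). Sorting does not affect
∑ d, a centred sum of independent variables with variance L³/12. The limit is thus 1/6 - 1/12. -/

namespace GridPoisson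

/-! ### Monge costs and optimality of the increasing matching -/

/-- A cost with the Monge property is minimised by the identity permutation. -/
theorem sum_le_sum_comp_perm_of_monge {n : ℕ} (f : Fin n → Fin n → ℝ)
    (hf : ∀ i i' j j', i ≤ i' → j ≤ j' → f i j + f i' j' ≤ f i j' + f i' j)
    (σ : Equiv.Perm (Fin n)) : ∑ i, f i i ≤ ∑ i, f i (σ i) := by
  induction n with
  | zero => simp
  | succ n ih =>
    -- `τ` is `σ` with the pair at the last index uncrossed: it fixes the last index and sends the
    -- preimage of the last index to `σ (Fin.last n)`. Only these two rows change, and the Monge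
    -- inequality compares them.
    set τ : Equiv.Perm (Fin (n + 1)) := σ.trans (Equiv.swap (Fin.last n) (σ (Fin.last n))) with hτ
    have hlast : τ (Fin.last n) = Fin.last n := by simp [hτ]
    have hne : ∀ i : Fin n, τ i.castSucc ≠ Fin.last n := fun i h => by
      have := τ.injective (h.trans hlast.symm)
      exact (Fin.castSucc_lt_last i).ne this
    have hstep : ∑ i, f i (τ i) ≤ ∑ i, f i (σ i) := by
      by_cases h : σ (Fin.last n) = Fin.last n
      · simp [hτ, h]
      set k := σ.symm (Fin.last n) with hk
      have hσk : σ k = Fin.last n := by simp [hk]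
      have hkl : k ≠ Fin.last n := fun e => h (by rw [← e, hσk, e])
      have hτk : τ k = σ (Fin.last n) := by simp [hτ, hσk]
      rw [← Finset.add_sum_erase _ _ (Finset.mem_univ k),
        ← Finset.add_sum_erase _ _ (Finset.mem_univ k),
        ← Finset.add_sum_erase _ _ (Finset.mem_erase.2 ⟨hkl.symm, Finset.mem_univ _⟩),
        ← Finset.add_sum_erase (Finset.univ.erase k) (fun i => f i (σ i))
          (Finset.mem_erase.2 ⟨hkl.symm, Finset.mem_univ _⟩), ← add_assoc, ← add_assoc]
      refine add_le_add ?_ (Finset.sum_le_sum fun i hi => ?_)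
      · rw [hτk, hlast, hσk]
        exact hf _ _ _ _ (Fin.le_last _) (Fin.le_last _)
      · simp only [Finset.mem_erase, Finset.mem_univ, and_true] at hi
        have h1 : σ i ≠ Fin.last n := fun e => hi.2 (by rw [hk, ← e]; simp)
        have h2 : σ i ≠ σ (Fin.last n) := fun e => hi.1 (σ.injective e)
        rw [hτ, Equiv.trans_apply, Equiv.swap_apply_of_ne_of_ne h1 h2]
    refine le_trans ?_ hstep
    rw [Fin.sum_univ_castSucc, Fin.sum_univ_castSucc, hlast]
    refine add_le_add ?_ le_rfl
    let g : Fin n → Fin n := fun i => (τ i.castSucc).castPred (hne i)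
    have hg : Function.Injective g := fun i j h => by
      have := Fin.castPred_inj.1 h
      exact Fin.castSucc_injective _ (τ.injective this)
    have := ih (fun i j => f i.castSucc j.castSucc)
      (fun i i' j j' h h' => hf _ _ _ _ (by simpa using h) (by simpa using h'))
      (Equiv.ofBijective g (Finite.injective_iff_bijective.1 hg))
    simpa [g] using this

theorem convexOn_abs_rpow {p : ℝ} (hp : 1 ≤ p) : ConvexOn ℝ Set.univ fun x : ℝ => |x| ^ p := by
  refine ⟨convex_univ, fun x _ y _ a b ha hb hab => ?_⟩
  simp only [smul_eq_mul]
  have h1 : |a * x + b * y| ≤ a * |x| + b * |y| := by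
    refine (abs_add_le _ _).trans ?_
    rw [abs_mul, abs_mul, abs_of_nonneg ha, abs_of_nonneg hb]
  refine (Real.rpow_le_rpow (abs_nonneg _) h1 (by linarith)).trans ?_
  exact (convexOn_rpow hp).2 (abs_nonneg x) (abs_nonneg y) ha hb hab

/-- Since the two sums agree, `b` and `c` are convex combinations of `a` and `d` with exchanged
weights; adding the two convexity inequalities gives the claim. The case `a = d` is separate because
the weight divides by `d - a`. -/
theorem convexOn_add_le_add_of_mem_Icc {φ : ℝ → ℝ} (hφ : ConvexOn ℝ Set.univ φ) {a b c d : ℝ}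
    (hb : b ∈ Set.Icc a d) (h : b + c = a + d) : φ b + φ c ≤ φ a + φ d := by
  obtain ⟨h1, h2⟩ := hb
  rcases eq_or_lt_of_le (h1.trans h2) with had | had
  · have : b = a := by linarith
    have : c = d := by linarith
    simp [*]
  have hd : 0 < d - a := by linarith
  set t := (b - a) / (d - a) with ht
  have ht0 : 0 ≤ t := div_nonneg (by linarith) hd.le
  have ht1 : t ≤ 1 := (div_le_one hd).2 (by linarith)
  have htd : t * (d - a) = b - a := div_mul_cancel₀ _ hd.ne'
  have e1 := hφ.2 (Set.mem_univ a) (Set.mem_univ d) (sub_nonneg.2 ht1) ht0 (by ring)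
  have e2 := hφ.2 (Set.mem_univ a) (Set.mem_univ d) ht0 (sub_nonneg.2 ht1) (by ring)
  simp only [smul_eq_mul] at e1 e2
  rw [show (1 - t) * a + t * d = b by linarith] at e1
  rw [show t * a + (1 - t) * d = c by linarith] at e2
  linarith

/-- `optimalCost` of a square cost matrix, with the blue points relabelled. -/
theorem optimalCost_eq_of_monge {n : ℕ} (w : Fin n → Fin n → ℝ) (τ : Equiv.Perm (Fin n))
    (hf : ∀ i i' j j', i ≤ i' → j ≤ j' →
      w i (τ j) + w i' (τ j') ≤ w i (τ j') + w i' (τ j)) :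
    optimalCost w = ∑ i, w i (τ i) := by
  obtain ⟨⟨π, hπ⟩, hle⟩ := exists_matchingCost_eq_optimalCost le_rfl w
  refine le_antisymm (hle τ.toEmbedding) ?_
  rw [← hπ, matchingCost]
  have := sum_le_sum_comp_perm_of_monge (fun i j => w i (τ j)) hf
    ((Equiv.embeddingEquivOfFinite _ π).trans τ.symm)
  simp only [Equiv.trans_apply, Equiv.apply_symm_apply] at this
  exact this

theorem redPoint_mono {L : ℕ} : Monotone (redPoint (L := L)) := fun i j h => by
  unfold redPoint
  have : (i : ℝ) ≤ j := by exact_mod_cast h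
  linarith

/-- The increasing rearrangement of the blue points. -/
noncomputable def sortedBlue {L : ℕ} (b : Fin L → ℝ) (i : Fin L) : ℝ := b (Tuple.sort b i)

theorem sortedBlue_mono {L : ℕ} (b : Fin L → ℝ) : Monotone (sortedBlue b) := Tuple.monotone_sort b

/-- Of the four differences between two ordered red and two ordered blue points, the uncrossed ones
lie between the crossed ones and have the same sum, so convexity yields the Monge property. -/
theorem criticalOpenCost_eq {p : ℝ} (hp : 1 ≤ p) {L : ℕ} (b : Fin L → ℝ) :
    criticalOpenCost p L b = ∑ i, |sortedBlue b i - redPoint i| ^ p := by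
  unfold criticalOpenCost openOptimalCost
  refine optimalCost_eq_of_monge _ (Tuple.sort b) fun i i' j j' hi hj => ?_
  have h1 := redPoint_mono hi
  have h2 : sortedBlue b j ≤ sortedBlue b j' := sortedBlue_mono b hj
  unfold sortedBlue at h2
  have := convexOn_add_le_add_of_mem_Icc (convexOn_abs_rpow hp)
    (a := b (Tuple.sort b j) - redPoint i') (b := b (Tuple.sort b j) - redPoint i)
    (c := b (Tuple.sort b j') - redPoint i') (d := b (Tuple.sort b j') - redPoint i)
    ⟨by linarith, by linarith⟩ (by ring)
  linarith

/-! ### Quantile function versus counting function -/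

/-- The number of blue points in `(-∞, x]`. -/
noncomputable def blueCount {L : ℕ} (b : Fin L → ℝ) (x : ℝ) : ℝ := ∑ j, if b j ≤ x then 1 else 0

theorem blueCount_eq_sum_sortedBlue {L : ℕ} (b : Fin L → ℝ) (x : ℝ) :
    blueCount b x = ∑ j, if sortedBlue b j ≤ x then 1 else 0 :=
  (Equiv.sum_comp (Tuple.sort b) fun j => if b j ≤ x then (1 : ℝ) else 0).symm

theorem blueCount_eq_of_sortedBlue {L : ℕ} (b : Fin L → ℝ) {x : ℝ} {k : ℕ} (hk : k ≤ L)
    (h1 : ∀ i : Fin L, (i : ℕ) < k → sortedBlue b i ≤ x)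
    (h2 : ∀ i : Fin L, k ≤ (i : ℕ) → x < sortedBlue b i) : blueCount b x = k := by
  rw [blueCount_eq_sum_sortedBlue]
  have : ∀ i : Fin L, (if sortedBlue b i ≤ x then (1 : ℝ) else 0) = if (i : ℕ) < k then 1 else 0 := by
    intro i
    by_cases h : (i : ℕ) < k
    · simp [h, h1 i h]
    · simp [h, h2 i (not_lt.1 h)]
  rw [Finset.sum_congr rfl fun i _ => this i, Fin.sum_univ_eq_sum_range
    (fun i => if i < k then (1 : ℝ) else 0), Finset.sum_ite]
  have : (Finset.range L).filter (· < k) = Finset.range k := by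
    ext i; simp; omega
  simp [this]

/-- A path that moves from `γ k - k` to `γ (k + 1) - k` and then jumps back by one has net integral
from `γ 0` to `γ n - n`. Thus the drift parts and the jump parts differ only by a boundary term. -/
theorem sum_integral_shift_eq {g : ℝ → ℝ} (hg : Continuous g) (γ : ℕ → ℝ) (n : ℕ) :
    ∑ k ∈ Finset.range n, ∫ t in (γ k - k)..(γ (k + 1) - k), g t =
      ∑ k ∈ Finset.range n, (∫ t in (γ (k + 1) - (k + 1))..(γ (k + 1) - k), g t) +
        ∫ t in (γ 0)..(γ n - n), g t := by
  induction n with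
  | zero => simp
  | succ n ih =>
    rw [Finset.sum_range_succ, Finset.sum_range_succ, ih]
    have hi : ∀ a b, IntervalIntegrable g volume a b := fun a b => hg.intervalIntegrable a b
    have e1 := intervalIntegral.integral_add_adjacent_intervals (hi (γ 0) (γ n - n))
      (hi (γ n - n) (γ (n + 1) - n))
    have e2 := intervalIntegral.integral_add_adjacent_intervals
      (hi (γ 0) (γ (n + 1) - (n + 1))) (hi (γ (n + 1) - (n + 1)) (γ (n + 1) - n))
    push_cast
    linarith

/-- The `p`-th power distance between the quantile function and the identity equals the one
between the distribution function and the identity. -/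
theorem integral_abs_sortedBlue_sub {p : ℝ} (hp : 0 < p) {L : ℕ} (b : Fin L → ℝ)
    (hb : ∀ i, b i ∈ Set.Icc (0 : ℝ) L) :
    ∑ i : Fin L, ∫ u in (i : ℝ)..(i + 1), |sortedBlue b i - u| ^ p =
      ∫ x in (0 : ℝ)..L, |blueCount b x - x| ^ p := by
  set g : ℝ → ℝ := fun t => |t| ^ p with hgdef
  have hg : Continuous g := continuous_abs.rpow_const fun _ => Or.inr hp.le
  have hs : ∀ i, sortedBlue b i ∈ Set.Icc (0 : ℝ) L := fun i => hb _
  -- The sorted points with indices shifted by one, padded by 0 at index 0 and by `L` beyond index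
  -- `L`, so that the count is `k` strictly between `γ k` and `γ (k + 1)`.
  set γ : ℕ → ℝ := fun k => if k = 0 then 0 else
    if h : k - 1 < L then sortedBlue b ⟨k - 1, h⟩ else L with hγ
  have γ0 : γ 0 = 0 := by simp [hγ]
  have γs : ∀ (k : ℕ) (h : k < L), γ (k + 1) = sortedBlue b ⟨k, h⟩ := fun k h => by simp [hγ, h]
  have γL : γ (L + 1) = L := by simp [hγ]
  have γmono : ∀ k, γ k ≤ γ (k + 1) := by
    intro k
    rcases k with _ | k
    · rw [γ0]
      by_cases h : 0 < L
      · rw [γs 0 h]; exact (hs _).1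
      · simp [hγ, h]
    · by_cases h : k + 1 < L
      · rw [γs k (by omega), γs _ h]
        exact sortedBlue_mono b (by simp)
      · have e : γ (k + 1 + 1) = L := by simp [hγ, h]
        rw [e]
        by_cases h' : k < L
        · rw [γs k h']; exact (hs _).2
        · simp [hγ, h']
  have hmono : Monotone γ := monotone_nat_of_le_succ γmono
  have hcount : ∀ k, k ≤ L → ∀ x, γ k < x → x < γ (k + 1) → blueCount b x = k := by
    intro k hk x h1 h2
    refine blueCount_eq_of_sortedBlue b hk (fun i hi => ?_) (fun i hi => ?_)
    · rw [← γs i i.2]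
      exact (hmono (by omega)).trans h1.le
    · rw [← γs i i.2]
      exact h2.trans_le (hmono (by omega))
  have hcongr : ∀ k, k ≤ L → ∀ x ∈ Set.uIoo (γ k) (γ (k + 1)),
      |blueCount b x - x| ^ p = g (x - k) := by
    intro k hk x hx
    rw [Set.uIoo_of_le (γmono k)] at hx
    rw [hcount k hk x hx.1 hx.2, abs_sub_comm]
  have e1 : ∫ x in (0 : ℝ)..L, |blueCount b x - x| ^ p =
      ∑ k ∈ Finset.range (L + 1), ∫ t in (γ k - k)..(γ (k + 1) - k), g t := by
    rw [← γL, ← γ0, ← intervalIntegral.sum_integral_adjacent_intervals]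
    · refine Finset.sum_congr rfl fun k hk => ?_
      rw [← intervalIntegral.integral_comp_sub_right (fun x => g x) (k : ℝ)]
      refine intervalIntegral.integral_congr_uIoo fun x hx => ?_
      exact hcongr k (by simpa [Nat.lt_succ_iff] using hk) x hx
    · intro k hk
      have : IntervalIntegrable (fun x => g (x - k)) volume (γ k) (γ (k + 1)) :=
        (hg.comp (continuous_id.sub continuous_const)).intervalIntegrable _ _
      refine this.congr_uIoo fun x hx => ?_
      exact (hcongr k (by omega) x hx).symm
  have e2 : ∑ i : Fin L, ∫ u in (i : ℝ)..(i + 1), |sortedBlue b i - u| ^ p =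
      ∑ k ∈ Finset.range L, ∫ t in (γ (k + 1) - (k + 1))..(γ (k + 1) - k), g t := by
    rw [← Fin.sum_univ_eq_sum_range
      (fun k => ∫ t in (γ (k + 1) - (k + 1))..(γ (k + 1) - k), g t)]
    refine Finset.sum_congr rfl fun i _ => ?_
    rw [← intervalIntegral.integral_comp_sub_left (fun x => g x), γs i i.2]
  -- With `L + 1` intervals the identity contains an extra jump at the padding value `L`, an
  -- integral from -1 to 0; it cancels against the boundary term from 0 to -1.
  rw [e1, e2, sum_integral_shift_eq hg, Finset.sum_range_succ, γL, γ0]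
  rw [sub_self, intervalIntegral.integral_symm (0 : ℝ) (L - (L + 1))]
  push_cast
  simp

/-! ### Comparing the open cost with the integrated fluctuation of the count -/

/-- A quantitative form of the continuity of `x ↦ |x| ^ p`. -/
theorem abs_add_rpow_le {p : ℝ} (hp : 1 ≤ p) {t : ℝ} (ht0 : 0 < t) (ht1 : t < 1) (a h : ℝ) :
    |a + h| ^ p ≤ (1 - t) ^ (1 - p) * |a| ^ p + t ^ (1 - p) * |h| ^ p := by
  have ht : 0 < 1 - t := by linarith
  have := (convexOn_abs_rpow hp).2 (Set.mem_univ (a / (1 - t))) (Set.mem_univ (h / t)) ht.le ht0.le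
    (by ring)
  simp only [smul_eq_mul] at this
  rw [mul_div_cancel₀ _ ht.ne', mul_div_cancel₀ _ ht0.ne', abs_div, abs_div, abs_of_pos ht,
    abs_of_pos ht0, Real.div_rpow (abs_nonneg _) ht.le, Real.div_rpow (abs_nonneg _) ht0.le] at this
  rw [Real.rpow_sub ht, Real.rpow_sub ht0, Real.rpow_one, Real.rpow_one]
  calc _ ≤ _ := this
    _ = _ := by ring

/-- The red point is the midpoint of its unit cell, so exchanging it with any point of the cell
perturbs the difference by at most 1/2, whose p-th power is absorbed by the constant 1. The
parameter `t` is kept free so that it can tend to 0 with `L`. -/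
theorem integral_abs_rpow_comparison {p : ℝ} (hp : 1 ≤ p) {t : ℝ} (ht0 : 0 < t) (ht1 : t < 1)
    (x a : ℝ) :
    |x - (a + 1 / 2)| ^ p ≤
        (1 - t) ^ (1 - p) * (∫ u in a..(a + 1), |x - u| ^ p) + t ^ (1 - p) ∧
      (∫ u in a..(a + 1), |x - u| ^ p) ≤
        (1 - t) ^ (1 - p) * |x - (a + 1 / 2)| ^ p + t ^ (1 - p) := by
  have hp0 : 0 < p := by linarith
  have hc : Continuous fun u : ℝ => |x - u| ^ p :=
    (continuous_const.sub continuous_id).abs.rpow_const fun _ => Or.inr hp0.le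
  have hsmall : ∀ h : ℝ, |h| ≤ 1 / 2 → t ^ (1 - p) * |h| ^ p ≤ t ^ (1 - p) := fun h hh =>
    mul_le_of_le_one_right (Real.rpow_nonneg ht0.le _)
      (Real.rpow_le_one (abs_nonneg _) (by linarith) hp0.le)
  constructor
  · have : ∫ _ in a..(a + 1), |x - (a + 1 / 2)| ^ p ≤
        ∫ u in a..(a + 1), ((1 - t) ^ (1 - p) * |x - u| ^ p + t ^ (1 - p)) := by
      refine intervalIntegral.integral_mono_on (by linarith) (by simp)
        (Continuous.intervalIntegrable (by fun_prop) _ _) fun u hu => ?_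
      have := abs_add_rpow_le hp ht0 ht1 (x - u) (u - (a + 1 / 2))
      rw [sub_add_sub_cancel] at this
      exact this.trans (add_le_add le_rfl (hsmall _ (abs_le.2 ⟨by linarith [hu.1], by linarith [hu.2]⟩)))
    rw [intervalIntegral.integral_add (Continuous.intervalIntegrable (by fun_prop) _ _) (by simp),
      intervalIntegral.integral_const_mul] at this
    simpa using this
  · have : ∫ u in a..(a + 1), |x - u| ^ p ≤
        ∫ _ in a..(a + 1), ((1 - t) ^ (1 - p) * |x - (a + 1 / 2)| ^ p + t ^ (1 - p)) := by
      refine intervalIntegral.integral_mono_on (by linarith)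
        (hc.intervalIntegrable _ _) (by simp) fun u hu => ?_
      have := abs_add_rpow_le hp ht0 ht1 (x - (a + 1 / 2)) (a + 1 / 2 - u)
      rw [sub_add_sub_cancel] at this
      exact this.trans (add_le_add le_rfl (hsmall _ (abs_le.2 ⟨by linarith [hu.2], by linarith [hu.1]⟩)))
    simpa using this

theorem criticalOpenCost_comparison {p : ℝ} (hp : 1 ≤ p) {t : ℝ} (ht0 : 0 < t) (ht1 : t < 1)
    {L : ℕ} (b : Fin L → ℝ) (hb : ∀ i, b i ∈ Set.Icc (0 : ℝ) L) :
    criticalOpenCost p L b ≤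
        (1 - t) ^ (1 - p) * (∫ x in (0 : ℝ)..L, |blueCount b x - x| ^ p) + L * t ^ (1 - p) ∧
      (∫ x in (0 : ℝ)..L, |blueCount b x - x| ^ p) ≤
        (1 - t) ^ (1 - p) * criticalOpenCost p L b + L * t ^ (1 - p) := by
  rw [criticalOpenCost_eq hp, ← integral_abs_sortedBlue_sub (by linarith) b hb]
  have hL : (L : ℝ) * t ^ (1 - p) = ∑ _i : Fin L, t ^ (1 - p) := by simp
  rw [hL, Finset.mul_sum, Finset.mul_sum, ← Finset.sum_add_distrib, ← Finset.sum_add_distrib]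
  exact ⟨Finset.sum_le_sum fun i _ =>
      (integral_abs_rpow_comparison hp ht0 ht1 (sortedBlue b i) (i : ℝ)).1,
    Finset.sum_le_sum fun i _ =>
      (integral_abs_rpow_comparison hp ht0 ht1 (sortedBlue b i) (i : ℝ)).2⟩

/-! ### Duality for quasi-periodic sequences -/

theorem exists_int_primitive (a : ℤ → ℝ) : ∃ A : ℤ → ℝ, ∀ z, A (z + 1) - A z = a z := by
  refine ⟨fun z => ∑ k ∈ Finset.Ico 0 z, a k - ∑ k ∈ Finset.Ico z 0, a k, fun z => ?_⟩
  rcases le_or_gt 0 z with h | h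
  · have e : Finset.Ico 0 (z + 1) = insert z (Finset.Ico 0 z) := by
      ext; simp; omega
    beta_reduce
    rw [e, Finset.sum_insert (by simp), Finset.Ico_eq_empty (by omega : ¬ z < 0),
      Finset.Ico_eq_empty (by omega : ¬ z + 1 < 0)]
    ring
  · have e : Finset.Ico z 0 = insert z (Finset.Ico (z + 1) 0) := by
      ext; simp; omega
    beta_reduce
    rw [e, Finset.sum_insert (by simp), Finset.Ico_eq_empty (by omega : ¬ 0 < z),
      Finset.Ico_eq_empty (by omega : ¬ 0 < z + 1)]
    ring

/-- A sequence whose increments are averages of consecutive terms of a monotone sequence `c` is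
convex, with subgradient `c`. -/
theorem mul_sub_le_of_increments {c Φ : ℤ → ℝ} (hc : Monotone c)
    (hΦ : ∀ z, Φ (z + 1) - Φ z = (c z + c (z + 1)) / 2) (j z : ℤ) :
    c j * (z - j) ≤ Φ z - Φ j := by
  induction z using Int.inductionOn' (b := j) with
  | zero => simp
  | succ k hk ih =>
    have h1 := hΦ k
    have h2 := hc hk
    have h3 := hc (hk.trans (by omega : k ≤ k + 1))
    push_cast
    nlinarith
  | pred k hk ih =>
    have h1 := hΦ (k - 1)
    rw [sub_add_cancel] at h1
    have h2 := hc hk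
    have h3 := hc ((by omega : k - 1 ≤ k).trans hk)
    push_cast
    nlinarith

theorem sum_range_periodic_add {g : ℤ → ℝ} {L : ℕ} (hg : Function.Periodic g (L : ℤ)) (k : ℤ) :
    ∑ i ∈ Finset.range L, g (i + k) = ∑ i ∈ Finset.range L, g i := by
  have step : ∀ k, ∑ i ∈ Finset.range L, g (i + (k + 1)) = ∑ i ∈ Finset.range L, g (i + k) := by
    intro k
    rw [← sub_eq_zero, ← Finset.sum_sub_distrib]
    have := Finset.sum_range_sub (fun i : ℕ => g (i + k)) L
    have e : g (L + k) = g k := by rw [add_comm]; exact hg k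
    simp only [e, Nat.cast_zero, zero_add, sub_self] at this
    rw [← this]
    refine Finset.sum_congr rfl fun i _ => ?_
    congr 2
    push_cast
    ring
  induction k using Int.induction_on with
  | zero => simp
  | succ k ih => rw [step, ih]
  | pred k ih => rw [← ih, ← step, sub_add_cancel]

/-- The quasi-periodic extension of a finite sequence. -/
noncomputable def quasiPeriodicExtension {L : ℕ} (hL : 0 < L) (β : Fin L → ℝ) (z : ℤ) : ℝ :=
  β ⟨(z % L).toNat, by
    have := Int.emod_nonneg z (by omega : (L : ℤ) ≠ 0)
    have := Int.emod_lt_of_pos z (by omega : 0 < (L : ℤ))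
    omega⟩ + L * ((z / L : ℤ) : ℝ)

theorem quasiPeriodicExtension_coe {L : ℕ} (hL : 0 < L) (β : Fin L → ℝ) (i : Fin L) :
    quasiPeriodicExtension hL β i = β i := by
  have h1 : ((i : ℕ) : ℤ) % L = i := Int.emod_eq_of_lt (by omega) (by omega)
  have h2 : ((i : ℕ) : ℤ) / L = 0 := Int.ediv_eq_zero_of_lt (by omega) (by omega)
  simp [quasiPeriodicExtension, h1, h2]

theorem quasiPeriodicExtension_add {L : ℕ} (hL : 0 < L) (β : Fin L → ℝ) (z : ℤ) :
    quasiPeriodicExtension hL β (z + L) = quasiPeriodicExtension hL β z + L := by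
  have h2 : (z + L) / (L : ℤ) = z / L + 1 := Int.add_ediv_of_dvd_right (dvd_refl _) |>.trans (by
    rw [Int.ediv_self (by omega)])
  simp only [quasiPeriodicExtension, Int.add_emod_right, h2]
  push_cast
  ring

/-- Within a period this is monotonicity of `β`; across periods it holds because all values of `β`
lie in an interval of length `L`. -/
theorem quasiPeriodicExtension_mono {L : ℕ} (hL : 0 < L) {β : Fin L → ℝ} (hβ : Monotone β)
    (hb : ∀ i, β i ∈ Set.Icc (0 : ℝ) L) : Monotone (quasiPeriodicExtension hL β) := by
  intro z z' h
  have hL' : (0 : ℝ) < L := by exact_mod_cast hL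
  rcases eq_or_lt_of_le (Int.ediv_le_ediv (by omega : 0 < (L : ℤ)) h) with e | e
  · simp only [quasiPeriodicExtension, e]
    refine add_le_add (hβ ?_) le_rfl
    have h1 := Int.emod_add_mul_ediv z L
    have h2 := Int.emod_add_mul_ediv z' L
    rw [e] at h1
    simp only [Fin.mk_le_mk]
    omega
  · simp only [quasiPeriodicExtension]
    have h1 := (hb ⟨(z % L).toNat, by
      have := Int.emod_nonneg z (by omega : (L : ℤ) ≠ 0)
      have := Int.emod_lt_of_pos z (by omega : 0 < (L : ℤ))
      omega⟩).2
    have h2 := (hb ⟨(z' % L).toNat, by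
      have := Int.emod_nonneg z' (by omega : (L : ℤ) ≠ 0)
      have := Int.emod_lt_of_pos z' (by omega : 0 < (L : ℤ))
      omega⟩).1
    have h3 : ((z / L : ℤ) : ℝ) + 1 ≤ ((z' / L : ℤ) : ℝ) := by exact_mod_cast e
    nlinarith

/-- A quasi-periodic increasing sequence of mean displacement zero is optimally matched. -/
theorem sum_sq_sub_le_of_quasiPeriodic {L : ℕ} {c : ℤ → ℝ} (hc : Monotone c)
    (hcL : ∀ z, c (z + L) = c z + L)
    (hmean : ∑ i ∈ Finset.range L, (c i - (i + 1 / 2)) = 0)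
    (σ : Equiv.Perm (Fin L)) (ν : Fin L → ℤ) (K : ℤ) :
    ∑ i : Fin L, (c i - (i + 1 / 2)) ^ 2 ≤
      ∑ i : Fin L, (c (σ i) - (i + ν i * L - K + 1 / 2)) ^ 2 := by
  -- `Φ` is a discrete convex potential with subgradient `c`. Averaging neighbouring values matches
  -- the increments of `(z + 1/2)² / 2`, so the increments of `g` are averages of `-e` with no stray
  -- constant.
  obtain ⟨Φ, hΦ⟩ := exists_int_primitive fun z => (c z + c (z + 1)) / 2
  set g : ℤ → ℝ := fun z => ((z : ℝ) + 1 / 2) ^ 2 / 2 - Φ z with hg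
  set e : ℤ → ℝ := fun z => c z - (z + 1 / 2) with he
  have hgs : ∀ z, g (z + 1) - g z = - (e z + e (z + 1)) / 2 := by
    intro z
    have := hΦ z
    simp only [hg, he]
    push_cast
    linarith
  have heL : ∀ z, e (z + L) = e z := fun z => by
    simp only [he, hcL]
    push_cast
    ring
  have hstep : ∀ z, g (z + 1 + L) - g (z + 1) = g (z + L) - g z := by
    intro z
    have h1 := hgs z
    have h2 := hgs (z + L)
    rw [heL, show z + L + 1 = z + 1 + L by ring, heL] at h2
    linarith
  -- The increment of `g` over a period is minus the sum of `e` over a period, which vanishes by the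
  -- mean-zero hypothesis. This is what makes the dual potential well defined on the circle.
  have h0 : g (0 + L) - g 0 = 0 := by
    have := Finset.sum_range_sub (fun i : ℕ => g i) L
    simp only [Nat.cast_zero, Nat.cast_succ, hgs] at this
    rw [zero_add, ← this]
    have h1 : ∑ i ∈ Finset.range L, e ((i : ℤ) + 1) = ∑ i ∈ Finset.range L, e i :=
      sum_range_periodic_add heL 1
    have h2 : ∑ i ∈ Finset.range L, e i = 0 := by simpa [he] using hmean
    rw [← Finset.sum_div, Finset.sum_neg_distrib, Finset.sum_add_distrib, h1, h2]
    simp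
  have hper : Function.Periodic g (L : ℤ) := by
    intro z
    rw [← sub_eq_zero]
    induction z using Int.induction_on with
    | zero => exact h0
    | succ k ih => rw [hstep, ih]
    | pred k ih => rw [← ih, ← hstep, sub_add_cancel]
  -- The subgradient inequality at `σ i`, tested at `i - K + ν i * L`, becomes a lower bound for the
  -- squared distance. Periodicity removes `ν i * L`; after summation the potentials cancel, since
  -- `σ` permutes and `K` only shifts a full period.
  have hterm : ∀ i : Fin L, (e (σ i)) ^ 2 + 2 * g (i + -K) - 2 * g (σ i) ≤
      (c (σ i) - (i + ν i * L - K + 1 / 2)) ^ 2 := by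
    intro i
    have h1 : g (i + -K) = g (i + -K + ν i * L) := by
      have := (hper.int_mul (ν i)) (i + -K)
      simpa using this.symm
    have h2 := mul_sub_le_of_increments hc hΦ (σ i) (i + -K + ν i * L)
    rw [h1]
    simp only [hg, he]
    push_cast at h2 ⊢
    nlinarith
  refine le_trans (le_of_eq ?_) (Finset.sum_le_sum fun i _ => hterm i)
  rw [Finset.sum_sub_distrib, Finset.sum_add_distrib]
  have h1 : ∑ i : Fin L, e (σ i) ^ 2 = ∑ i : Fin L, (c i - (i + 1 / 2)) ^ 2 := by
    rw [Equiv.sum_comp σ fun i : Fin L => e i ^ 2]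
    simp [he]
  have h2 : ∑ i : Fin L, 2 * g (i + -K) = ∑ i : Fin L, 2 * g (σ i) := by
    rw [Equiv.sum_comp σ fun i : Fin L => 2 * g i, ← Finset.mul_sum, ← Finset.mul_sum,
      Fin.sum_univ_eq_sum_range (fun i => g (i + -K)), Fin.sum_univ_eq_sum_range (fun i => g i),
      sum_range_periodic_add hper]
  rw [h1, h2]
  ring

theorem sum_sq_sub_const {n : ℕ} (x : Fin n → ℝ) (c : ℝ) :
    ∑ i, (x i - c) ^ 2 = ∑ i, x i ^ 2 - 2 * c * ∑ i, x i + n * c ^ 2 := by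
  have : ∀ i, (x i - c) ^ 2 = x i ^ 2 - 2 * c * x i + c ^ 2 := fun i => by ring
  simp [this, Finset.sum_add_distrib, Finset.sum_sub_distrib, Finset.mul_sum]

/-! ### Two-sided bounds for the quadratic periodic cost -/

/-- The displacements of the increasing matching. -/
noncomputable def displacement {L : ℕ} (b : Fin L → ℝ) (i : Fin L) : ℝ := sortedBlue b i - redPoint i

theorem exists_periodicDist_eq {L : ℝ} (hL : 0 < L) (x y : ℝ) :
    ∃ ν : ℤ, periodicDist L x y = |y - x - ν * L| := by
  refine ⟨round ((y - x) / L), le_antisymm (ciInf_le ⟨0, ?_⟩ _) (le_ciInf fun ν => ?_)⟩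
  · rintro _ ⟨ν, rfl⟩
    exact abs_nonneg _
  · have h := mul_le_mul_of_nonneg_right (round_le ((y - x) / L) ν) hL.le
    have e : ∀ ν : ℤ, |(y - x) / L - ν| * L = |y - x - ν * L| := fun ν => by
      nth_rw 2 [← abs_of_pos hL]
      rw [← abs_mul, sub_mul, div_mul_cancel₀ _ hL.ne']
    rwa [e, e] at h

theorem periodicDist_le (L x y : ℝ) (ν : ℤ) : periodicDist L x y ≤ |y - x - ν * L| :=
  ciInf_le ⟨0, by rintro _ ⟨ν, rfl⟩; exact abs_nonneg _⟩ ν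

theorem periodicDist_nonneg (L x y : ℝ) : 0 ≤ periodicDist L x y :=
  Real.iInf_nonneg fun _ => abs_nonneg _

theorem le_criticalPeriodicCost {L : ℕ} (hL : 0 < L) (b : Fin L → ℝ)
    (hb : ∀ i, b i ∈ Set.Icc (0 : ℝ) L) :
    ∑ i, displacement b i ^ 2 - (∑ i, displacement b i) ^ 2 / L ≤ criticalPeriodicCost 2 L b := by
  have hL' : (0 : ℝ) < L := by exact_mod_cast hL
  obtain ⟨⟨π, hπ⟩, -⟩ := exists_matchingCost_eq_optimalCost le_rfl
    fun (i : Fin L) (j : Fin L) => periodicDist L (redPoint i) (b j) ^ (2 : ℝ)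
  rw [criticalPeriodicCost, periodicOptimalCost, ← hπ, matchingCost]
  choose ν hν using fun i : Fin L => exists_periodicDist_eq hL' (redPoint i) (b (π i))
  simp only [hν, Real.rpow_two, sq_abs]
  set m := (∑ i, displacement b i) / L with hm
  -- The total winding number: the unfolded displacements of the matching sum to `L * (m - K)`.
  -- Centring them at `m - K` gives the sum bounded by duality, and discards only the nonnegative
  -- term `L * (m - K)²`.
  set K := ∑ i, ν i with hK
  set σ : Equiv.Perm (Fin L) := (Equiv.embeddingEquivOfFinite _ π).trans (Tuple.sort b).symm with hσ
  have hbσ : ∀ i, b (π i) = sortedBlue b (σ i) := fun i => by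
    have : σ i = (Tuple.sort b).symm (π i) := rfl
    simp [sortedBlue, this]
  simp only [hbσ]
  set q := quasiPeriodicExtension hL (sortedBlue b) with hq
  have hqi : ∀ i : Fin L, q i = sortedBlue b i := quasiPeriodicExtension_coe hL _
  have hLm : ∑ i, displacement b i = L * m := by rw [hm]; field_simp
  have key := sum_sq_sub_le_of_quasiPeriodic (L := L) (c := fun z => q z - m)
    (fun z z' h => by
      have := quasiPeriodicExtension_mono hL (sortedBlue_mono b) (fun i => hb _) h
      simpa using this)
    (fun z => by
      simp only [hq, quasiPeriodicExtension_add]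
      ring)
    (by
      have : ∑ i : Fin L, (q i - m - ((i : ℝ) + 1 / 2)) = 0 := by
        have : ∀ i : Fin L, q i - m - ((i : ℝ) + 1 / 2) = displacement b i - m := fun i => by
          rw [hqi, displacement, redPoint]; ring
        rw [Finset.sum_congr rfl fun i _ => this i, Finset.sum_sub_distrib, hLm]
        simp
      rwa [Fin.sum_univ_eq_sum_range (fun i : ℕ => q i - m - ((i : ℝ) + 1 / 2))] at this)
    σ ν K
  have e1 : ∑ i : Fin L, (q i - m - ((i : ℝ) + 1 / 2)) ^ 2 =
      ∑ i, displacement b i ^ 2 - (∑ i, displacement b i) ^ 2 / L := by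
    have : ∀ i : Fin L, (q i - m - ((i : ℝ) + 1 / 2)) ^ 2 = (displacement b i - m) ^ 2 := fun i => by
      rw [hqi, displacement, redPoint]; ring
    simp only [this, sum_sq_sub_const, hLm]
    field_simp
    ring
  rw [← e1]
  refine key.trans ?_
  have e2 : ∀ i : Fin L, (q (σ i) - m - (i + ν i * L - K + 1 / 2)) ^ 2 =
      ((sortedBlue b (σ i) - redPoint i - ν i * L) - (m - K)) ^ 2 := fun i => by
    rw [hqi, redPoint]; ring
  have e3 : ∑ i, (sortedBlue b (σ i) - redPoint i - ν i * L) = L * (m - K) := by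
    rw [Finset.sum_sub_distrib, Finset.sum_sub_distrib, Equiv.sum_comp σ, ← Finset.sum_sub_distrib,
      ← Finset.sum_mul, mul_sub, ← hLm, hK]
    push_cast
    simp only [displacement]
    ring
  simp only [e2]
  rw [sum_sq_sub_const, e3]
  nlinarith [mul_nonneg hL'.le (sq_nonneg (m - K))]

/-- Rotating the increasing matching by `k` positions subtracts `k` from every displacement. Taking
`k` nearest to the mean `m` costs `L * (m - k)² ≤ L / 4` more than the ideal centring at `m`. -/
theorem criticalPeriodicCost_le {L : ℕ} (hL : 0 < L) (b : Fin L → ℝ) :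
    criticalPeriodicCost 2 L b ≤
      ∑ i, displacement b i ^ 2 - (∑ i, displacement b i) ^ 2 / L + L / 4 := by
  have hL' : (0 : ℝ) < L := by exact_mod_cast hL
  set m := (∑ i, displacement b i) / L with hm
  set k := round m with hk
  have hLm : ∑ i, displacement b i = L * m := by rw [hm]; field_simp
  have hlt : ∀ z : ℤ, 0 ≤ z % L ∧ z % L < L := fun z =>
    ⟨Int.emod_nonneg z (by omega), Int.emod_lt_of_pos z (by omega)⟩
  let s : Fin L → Fin L := fun i => ⟨(((i : ℕ) - k : ℤ) % L).toNat, by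
    have := hlt ((i : ℕ) - k : ℤ)
    omega⟩
  have hs : ∀ i, ((s i : ℕ) : ℤ) = ((i : ℕ) - k : ℤ) % L := fun i => by
    have := hlt ((i : ℕ) - k : ℤ)
    simp only [s]
    omega
  have hinj : Function.Injective s := by
    intro i j h
    have h1 : ((i : ℕ) - k : ℤ) % L = ((j : ℕ) - k : ℤ) % L := by rw [← hs, ← hs, h]
    have h2 : ((i : ℕ) : ℤ) ≡ ((j : ℕ) : ℤ) [ZMOD L] := by
      have : ((i : ℕ) - k : ℤ) ≡ ((j : ℕ) - k : ℤ) [ZMOD L] := h1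
      simpa using this.add_right k
    exact Fin.ext (Nat.ModEq.eq_of_lt_of_lt (Int.natCast_modEq_iff.1 h2) i.2 j.2)
  let σ : Equiv.Perm (Fin L) := Equiv.ofBijective s (Finite.injective_iff_bijective.1 hinj)
  have hle := (exists_matchingCost_eq_optimalCost le_rfl
    fun (i : Fin L) (j : Fin L) => periodicDist L (redPoint i) (b j) ^ (2 : ℝ)).2
    (σ.trans (Tuple.sort b)).toEmbedding
  rw [criticalPeriodicCost, periodicOptimalCost]
  refine hle.trans ?_
  have hterm : ∀ i, periodicDist L (redPoint i) (b (Tuple.sort b (σ i))) ^ (2 : ℝ) ≤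
      (displacement b (σ i) - k) ^ 2 := by
    intro i
    have h1 := periodicDist_le L (redPoint i) (b (Tuple.sort b (σ i))) (-(((i : ℕ) - k : ℤ) / L))
    have h2 : ((s i : ℕ) : ℤ) + L * (((i : ℕ) - k : ℤ) / L) = (i : ℕ) - k := by
      rw [hs]; exact Int.emod_add_mul_ediv _ _
    have h3 : ((σ i : ℕ) : ℝ) + L * ((((i : ℕ) - k : ℤ) / L : ℤ) : ℝ) = (i : ℕ) - k := by
      exact_mod_cast h2
    have h4 : b (Tuple.sort b (σ i)) - redPoint i - ((-(((i : ℕ) - k : ℤ) / L) : ℤ) : ℝ) * L =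
        displacement b (σ i) - k := by
      rw [displacement, sortedBlue, redPoint, redPoint]
      push_cast at h3 ⊢
      linarith
    rw [h4] at h1
    rw [Real.rpow_two, ← sq_abs (displacement b (σ i) - k)]
    exact pow_le_pow_left₀ (periodicDist_nonneg _ _ _) h1 2
  refine (Finset.sum_le_sum fun i _ => hterm i).trans ?_
  rw [Equiv.sum_comp σ fun i => (displacement b i - k) ^ 2, sum_sq_sub_const, hLm]
  have h5 : (m - k) ^ 2 ≤ 1 / 4 := by
    have := abs_le.1 (abs_sub_round m)
    nlinarith
  have h6 : (L * m) ^ 2 / L = L * m ^ 2 := by field_simp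
  rw [h6]
  nlinarith

theorem sum_redPoint (L : ℕ) : ∑ i : Fin L, redPoint i = (L : ℝ) ^ 2 / 2 := by
  unfold redPoint
  rw [Fin.sum_univ_eq_sum_range (fun i : ℕ => (i : ℝ) + 1 / 2)]
  induction L with
  | zero => simp
  | succ n ih => rw [Finset.sum_range_succ, ih]; push_cast; ring

theorem sum_displacement {L : ℕ} (b : Fin L → ℝ) :
    ∑ i, displacement b i = ∑ i, b i - (L : ℝ) ^ 2 / 2 := by
  simp only [displacement, sortedBlue, Finset.sum_sub_distrib, sum_redPoint]
  rw [Equiv.sum_comp]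

theorem sum_displacement_sq {L : ℕ} (b : Fin L → ℝ) :
    ∑ i, displacement b i ^ 2 = criticalOpenCost 2 L b := by
  rw [criticalOpenCost_eq (by norm_num)]
  simp [displacement, sq_abs]

/-! ### Convergence of moments and sub-Gaussian bounds -/

/-- Along a weakly convergent sequence of laws, integrals of a function with bounded second
moments converge. -/
theorem tendsto_integral_of_sq_bounded {μs : ℕ → ProbabilityMeasure ℝ} {μ : ProbabilityMeasure ℝ}
    (h : Tendsto μs atTop (𝓝 μ)) {f : ℝ → ℝ} (hf : Continuous f) (hf0 : ∀ x, 0 ≤ f x) {C : ℝ}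
    (hi : ∀ n, Integrable (fun x => f x ^ 2) (μs n)) (hC : ∀ n, ∫ x, f x ^ 2 ∂(μs n) ≤ C)
    (hi' : Integrable (fun x => f x ^ 2) μ) (hC' : ∫ x, f x ^ 2 ∂μ ≤ C) :
    Tendsto (fun n => ∫ x, f x ∂(μs n)) atTop (𝓝 (∫ x, f x ∂μ)) := by
  have hC0 : 0 ≤ C := (integral_nonneg fun x => sq_nonneg _).trans hC'
  -- The pointwise bound `f - min f M ≤ f² / M` makes the truncation error uniform over the laws;
  -- the truncated function is then a legitimate weak-convergence test function.
  have trunc : ∀ (ν : ProbabilityMeasure ℝ) (M : ℝ), 0 < M →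
      Integrable (fun x => f x ^ 2) ν → ∫ x, f x ^ 2 ∂ν ≤ C →
      |∫ x, f x ∂ν - ∫ x, min (f x) M ∂ν| ≤ C / M := by
    intro ν M hM hν hνC
    have h1 : Integrable f ν := by
      refine (hν.add (integrable_const (1 : ℝ))).mono' hf.aestronglyMeasurable
        (ae_of_all _ fun x => ?_)
      simp only [Pi.add_apply, Real.norm_eq_abs]
      rw [abs_of_nonneg (hf0 x)]
      nlinarith [sq_nonneg (f x - 1)]
    have h2 : Integrable (fun x => min (f x) M) ν := by
      refine h1.mono' (hf.min continuous_const).aestronglyMeasurable (ae_of_all _ fun x => ?_)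
      rw [Real.norm_eq_abs, abs_of_nonneg (le_min (hf0 x) hM.le)]
      exact min_le_left _ _
    rw [← integral_sub h1 h2, abs_of_nonneg (integral_nonneg fun x => by simp)]
    calc ∫ x, (f x - min (f x) M) ∂ν ≤ ∫ x, f x ^ 2 / M ∂ν := by
          refine integral_mono (h1.sub h2) (hν.div_const M) fun x => ?_
          simp only
          rw [le_div_iff₀ hM]
          have := hf0 x
          rcases le_total (f x) M with h | h
          · rw [min_eq_left h]; nlinarith
          · rw [min_eq_right h]; nlinarith
      _ = (∫ x, f x ^ 2 ∂ν) / M := integral_div _ _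
      _ ≤ C / M := by gcongr
  rw [Metric.tendsto_atTop]
  intro ε hε
  set M := 3 * C / ε + 1 with hM
  have hM0 : 0 < M := by positivity
  have hCM : C / M < ε / 3 := by
    rw [div_lt_iff₀ hM0, hM]
    have : ε / 3 * (3 * C / ε + 1) = C + ε / 3 := by field_simp
    linarith
  let F : BoundedContinuousFunction ℝ ℝ := BoundedContinuousFunction.ofNormedAddCommGroup
    (fun x => min (f x) M) (hf.min continuous_const) M fun x => by
      rw [Real.norm_eq_abs, abs_of_nonneg (le_min (hf0 x) hM0.le)]
      exact min_le_right _ _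
  have hF := ProbabilityMeasure.tendsto_iff_forall_integral_tendsto.1 h F
  obtain ⟨N, hN⟩ := Metric.tendsto_atTop.1 hF (ε / 3) (by positivity)
  refine ⟨N, fun n hn => ?_⟩
  have e1 := abs_le.1 (trunc (μs n) M hM0 (hi n) (hC n))
  have e2 := abs_le.1 (trunc μ M hM0 hi' hC')
  have e3 := hN n hn
  rw [Real.dist_eq, abs_lt] at e3 ⊢
  change _ < ∫ x, min (f x) M ∂(μs n : Measure ℝ) - ∫ x, min (f x) M ∂(μ : Measure ℝ) ∧
    ∫ x, min (f x) M ∂(μs n : Measure ℝ) - ∫ x, min (f x) M ∂(μ : Measure ℝ) < _ at e3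
  constructor <;> linarith [e1.1, e1.2, e2.1, e2.2, e3.1, e3.2]

theorem abs_rpow_le_exp_add {q : ℝ} (hq : 0 ≤ q) (x : ℝ) :
    |x| ^ q ≤ (⌈q⌉₊.factorial : ℝ) * (Real.exp x + Real.exp (-x)) := by
  have h1 : Real.exp |x| ≤ Real.exp x + Real.exp (-x) := by
    rcases abs_cases x with ⟨h, -⟩ | ⟨h, -⟩ <;> rw [h] <;> linarith [Real.exp_pos x, Real.exp_pos (-x)]
  have hfac : (1 : ℝ) ≤ (⌈q⌉₊.factorial : ℝ) := by exact_mod_cast Nat.factorial_pos _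
  refine le_trans ?_ (mul_le_mul_of_nonneg_left h1 (by linarith))
  rcases le_or_gt |x| 1 with h | h
  · have e1 := Real.rpow_le_one (abs_nonneg x) h hq
    have e2 := Real.one_le_exp (abs_nonneg x)
    nlinarith
  · have e1 : |x| ^ q ≤ |x| ^ (⌈q⌉₊ : ℝ) := Real.rpow_le_rpow_of_exponent_le h.le (Nat.le_ceil q)
    rw [Real.rpow_natCast] at e1
    have e2 := Real.pow_div_factorial_le_exp |x| (abs_nonneg x) ⌈q⌉₊
    rw [div_le_iff₀ (by linarith)] at e2
    linarith

/-- An upper bound for the `q`-th absolute moment of a sub-Gaussian variable of parameter `1`. -/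
noncomputable def subgaussianMomentBound (q : ℝ) : ℝ :=
  (⌈q⌉₊.factorial : ℝ) * (Real.exp 1 + Real.exp 1)

/-- Only the moment generating function at 1 and -1 is used, where it is at most `exp (1/2)`. The
bound depends on `q` alone, which gives the uniformity needed later. -/
theorem integrable_and_integral_abs_rpow_le {Ω : Type*} [MeasurableSpace Ω] {P : Measure Ω}
    {X : Ω → ℝ} {c : NNReal} (hX : HasSubgaussianMGF X c P) (hc : c ≤ 1) {q : ℝ} (hq : 0 ≤ q) :
    Integrable (fun ω => |X ω| ^ q) P ∧ ∫ ω, |X ω| ^ q ∂P ≤ subgaussianMomentBound q := by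
  have i1 : Integrable (fun ω => Real.exp (X ω)) P := by simpa using hX.integrable_exp_mul 1
  have i2 : Integrable (fun ω => Real.exp (-X ω)) P := by simpa using hX.integrable_exp_mul (-1)
  have i3 := (i1.add i2).const_mul (⌈q⌉₊.factorial : ℝ)
  have hc' : (c : ℝ) ≤ 1 := by exact_mod_cast hc
  have b1 : ∫ ω, Real.exp (X ω) ∂P ≤ Real.exp 1 := by
    have := hX.mgf_le 1
    simp only [mgf, one_mul] at this
    exact this.trans (Real.exp_le_exp.2 (by linarith))
  have b2 : ∫ ω, Real.exp (-X ω) ∂P ≤ Real.exp 1 := by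
    have := hX.mgf_le (-1)
    simp only [mgf, neg_mul, one_mul] at this
    exact this.trans (Real.exp_le_exp.2 (by linarith))
  have hi : Integrable (fun ω => |X ω| ^ q) P := by
    have hm := hX.aemeasurable
    refine i3.mono' (AEMeasurable.aestronglyMeasurable (by fun_prop)) (ae_of_all _ fun ω => ?_)
    rw [Real.norm_eq_abs, abs_of_nonneg (Real.rpow_nonneg (abs_nonneg _) _)]
    exact abs_rpow_le_exp_add hq _
  refine ⟨hi, (integral_mono hi i3 fun ω => abs_rpow_le_exp_add hq _).trans ?_⟩
  simp only [Pi.add_apply]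
  rw [integral_const_mul, integral_add i1 i2, subgaussianMomentBound]
  gcongr

/-! ### The uniform empirical process -/

/-- The uniform distribution on `[0, 1]`. -/
noncomputable def unifIcc : Measure ℝ := volume.restrict (Set.Icc 0 1)

instance : IsProbabilityMeasure unifIcc := ⟨by simp [unifIcc]⟩

/-- The law of a sequence of independent points, uniform on `[0, 1]`. -/
noncomputable def unifSeq : Measure (ℕ → ℝ) := Measure.infinitePi fun _ => unifIcc

instance : IsProbabilityMeasure unifSeq := by unfold unifSeq; infer_instance

theorem unifSeq_map_eval (k : ℕ) : unifSeq.map (fun ω => ω k) = unifIcc :=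
  Measure.infinitePi_map_eval _ k

theorem iIndepFun_unifSeq {X : ℝ → ℝ} (hX : Measurable X) :
    iIndepFun (fun k ω => X (ω k)) unifSeq :=
  iIndepFun_infinitePi (P := fun _ : ℕ => unifIcc) (X := fun _ => X) fun _ => hX

theorem identDistrib_unifSeq {X : ℝ → ℝ} (hX : Measurable X) (k : ℕ) :
    IdentDistrib (fun ω : ℕ → ℝ => X (ω k)) (fun ω => X (ω 0)) unifSeq unifSeq :=
  IdentDistrib.comp (f := fun ω : ℕ → ℝ => ω k) (g := fun ω : ℕ → ℝ => ω 0)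
    ⟨(measurable_pi_apply k).aemeasurable, (measurable_pi_apply 0).aemeasurable, by
      rw [unifSeq_map_eval, unifSeq_map_eval]⟩ hX

theorem integral_unifSeq_eval {X : ℝ → ℝ} (hX : Measurable X) (k : ℕ) :
    ∫ ω, X (ω k) ∂unifSeq = ∫ x in (0 : ℝ)..1, X x := by
  rw [intervalIntegral.integral_of_le zero_le_one, ← integral_Icc_eq_integral_Ioc,
    show volume.restrict (Set.Icc (0 : ℝ) 1) = unifSeq.map (fun ω => ω k) from
      (unifSeq_map_eval k).symm,
    integral_map (measurable_pi_apply k).aemeasurable hX.aestronglyMeasurable]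

theorem map_unifIcc_mul {L : ℝ} (hL : 0 < L) :
    unifIcc.map (fun x => L * x) = ProbabilityTheory.cond volume (Set.Icc (0 : ℝ) L) := by
  have e : (fun x : ℝ => L * x) ⁻¹' Set.Icc 0 L = Set.Icc 0 1 := by
    ext x
    simp only [Set.mem_preimage, Set.mem_Icc]
    constructor
    · rintro ⟨h1, h2⟩
      exact ⟨nonneg_of_mul_nonneg_right h1 hL, by nlinarith⟩
    · rintro ⟨h1, h2⟩
      exact ⟨by positivity, by nlinarith⟩
  rw [unifIcc, ← e, ← Measure.restrict_map (by fun_prop) measurableSet_Icc,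
    Real.map_volume_mul_left hL.ne', Measure.restrict_smul, ProbabilityTheory.cond, Real.volume_Icc,
    sub_zero, abs_of_pos (inv_pos.2 hL), ENNReal.ofReal_inv_of_pos hL]

/-- The blue points are the first terms of a uniform sequence, scaled by `L`. -/
theorem map_unifSeq_eq_blueLaw {L : ℕ} (hL : 0 < L) :
    unifSeq.map (fun ω (j : Fin L) => (L : ℝ) * ω j) = blueLaw L L := by
  have hi : iIndepFun (fun (j : Fin L) (ω : ℕ → ℝ) => (L : ℝ) * ω j) unifSeq :=
    (iIndepFun_unifSeq (X := fun x => (L : ℝ) * x) (by fun_prop)).precomp Fin.val_injective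
  rw [iIndepFun_iff_map_fun_eq_pi_map
    (fun j => Measurable.aemeasurable (by fun_prop))] at hi
  rw [hi, blueLaw]
  congr 1
  funext j
  rw [← map_unifIcc_mul (by exact_mod_cast hL : (0 : ℝ) < L), ← unifSeq_map_eval j,
    Measure.map_map (by fun_prop) (by fun_prop)]
  rfl

/-- The uniform empirical process at `s`. -/
noncomputable def empiricalFluctuation (n : ℕ) (s : ℝ) (ω : ℕ → ℝ) : ℝ :=
  (√n)⁻¹ * (∑ k ∈ Finset.range n, (if ω k ≤ s then 1 else 0) - n * s)

theorem measurable_step (s : ℝ) : Measurable fun x : ℝ => if x ≤ s then (1 : ℝ) else 0 :=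
  Measurable.ite measurableSet_Iic measurable_const measurable_const

theorem integral_step {s : ℝ} (hs : s ∈ Set.Icc (0 : ℝ) 1) (k : ℕ) :
    ∫ ω, (if ω k ≤ s then (1 : ℝ) else 0) ∂unifSeq = s := by
  rw [integral_unifSeq_eval (measurable_step s)]
  have h1 : IntervalIntegrable (fun x : ℝ => if x ≤ s then (1 : ℝ) else 0) volume 0 s :=
    (intervalIntegrable_const (c := (1 : ℝ))).congr_uIoo fun x hx => by
      rw [Set.uIoo_of_le hs.1] at hx
      simp [hx.2.le]
  have h2 : IntervalIntegrable (fun x : ℝ => if x ≤ s then (1 : ℝ) else 0) volume s 1 :=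
    (intervalIntegrable_const (c := (0 : ℝ))).congr_uIoo fun x hx => by
      rw [Set.uIoo_of_le hs.2] at hx
      simp [hx.1]
  rw [← intervalIntegral.integral_add_adjacent_intervals h1 h2,
    intervalIntegral.integral_congr_uIoo (g := fun _ => (1 : ℝ)) (fun x hx => by
      rw [Set.uIoo_of_le hs.1] at hx
      simp [hx.2.le]),
    intervalIntegral.integral_congr_uIoo (a := s) (g := fun _ => (0 : ℝ)) (fun x hx => by
      rw [Set.uIoo_of_le hs.2] at hx
      simp [hx.1])]
  simp

theorem step_mem_Icc (s x : ℝ) : (if x ≤ s then (1 : ℝ) else 0) ∈ Set.Icc (0 : ℝ) 1 := by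
  split_ifs <;> simp

theorem memLp_step (s : ℝ) (k : ℕ) :
    MemLp (fun ω : ℕ → ℝ => if ω k ≤ s then (1 : ℝ) else 0) 2 unifSeq :=
  memLp_of_bounded (a := 0) (b := 1) (ae_of_all _ fun ω : ℕ → ℝ => step_mem_Icc s (ω k))
    ((measurable_step s).comp (measurable_pi_apply k)).aestronglyMeasurable 2

theorem variance_step {s : ℝ} (hs : s ∈ Set.Icc (0 : ℝ) 1) :
    variance (fun ω : ℕ → ℝ => if ω 0 ≤ s then (1 : ℝ) else 0) unifSeq = s * (1 - s) := by
  rw [variance_eq_sub (memLp_step s 0)]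
  have : (fun ω : ℕ → ℝ => if ω 0 ≤ s then (1 : ℝ) else 0) ^ 2 =
      fun ω : ℕ → ℝ => if ω 0 ≤ s then (1 : ℝ) else 0 := by
    funext ω
    simp
  rw [this, integral_step hs]
  ring

/-- Hoeffding's lemma gives each centred indicator the parameter 1/4; independence adds these to `n
/ 4`, and the normalisation divides by `n`. For `n = 0` the inverse square root is 0 by convention,
which is harmless. -/
theorem hasSubgaussianMGF_empiricalFluctuation {s : ℝ} (hs : s ∈ Set.Icc (0 : ℝ) 1) (n : ℕ) :
    ∃ c ≤ 1, HasSubgaussianMGF (empiricalFluctuation n s) c unifSeq := by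
  have h1 : ∀ k ∈ Finset.range n, HasSubgaussianMGF
      (fun ω : ℕ → ℝ => (if ω k ≤ s then (1 : ℝ) else 0) - s) ((‖(1 : ℝ) - 0‖₊ / 2) ^ 2) unifSeq := by
    intro k _
    have := hasSubgaussianMGF_of_mem_Icc (μ := unifSeq)
      (X := fun ω : ℕ → ℝ => if ω k ≤ s then (1 : ℝ) else 0) (a := 0) (b := 1)
      ((measurable_step s).comp (measurable_pi_apply k)).aemeasurable
      (ae_of_all _ fun ω => step_mem_Icc s (ω k))
    rwa [integral_step hs] at this
  have h2 := (HasSubgaussianMGF.sum_of_iIndepFun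
    (iIndepFun_unifSeq ((measurable_step s).sub_const s)) h1).const_mul (√n)⁻¹
  have hle : ∀ a b : NNReal, (a : ℝ) * b ≤ 1 → a * b ≤ 1 := fun a b h => by exact_mod_cast h
  refine ⟨_, hle ⟨(√n)⁻¹ ^ 2, sq_nonneg _⟩ _ ?_, h2.congr (ae_of_all _ fun ω => ?_)⟩
  · change (√n)⁻¹ ^ 2 * _ ≤ (1 : ℝ)
    rw [inv_pow, Real.sq_sqrt (Nat.cast_nonneg n)]
    have : (n : ℝ)⁻¹ * n ≤ 1 := inv_mul_le_one
    simp only [sub_zero, nnnorm_one, Finset.sum_const, Finset.card_range, nsmul_eq_mul,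
      NNReal.coe_mul, NNReal.coe_natCast, NNReal.coe_pow, NNReal.coe_div, NNReal.coe_ofNat,
      NNReal.coe_one]
    nlinarith
  · simp [empiricalFluctuation, Finset.sum_sub_distrib]

/-- The `p`-th absolute moment of the uniform empirical process. -/
noncomputable def empiricalMoment (p : ℝ) (n : ℕ) (s : ℝ) : ℝ :=
  ∫ ω, |empiricalFluctuation n s ω| ^ p ∂unifSeq

theorem empiricalMoment_nonneg (p : ℝ) (n : ℕ) (s : ℝ) : 0 ≤ empiricalMoment p n s :=
  integral_nonneg fun _ => Real.rpow_nonneg (abs_nonneg _) _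

theorem empiricalMoment_le {p s : ℝ} (hp : 0 ≤ p) (hs : s ∈ Set.Icc (0 : ℝ) 1) (n : ℕ) :
    empiricalMoment p n s ≤ subgaussianMomentBound p := by
  obtain ⟨c, hc, h⟩ := hasSubgaussianMGF_empiricalFluctuation hs n
  exact (integrable_and_integral_abs_rpow_le h hc hp).2

theorem hasSubgaussianMGF_id_gaussianReal (v : NNReal) :
    HasSubgaussianMGF id v (gaussianReal 0 v) where
  integrable_exp_mul t := integrable_exp_mul_gaussianReal t
  mgf_le t := by rw [mgf_id_gaussianReal]; simp

/-- The central limit theorem gives convergence in law; the uniform bound on moments of order `p *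
2` gives the uniform integrability that passes it to moments of order `p`. -/
theorem tendsto_empiricalMoment {p s : ℝ} (hp : 0 < p) (hs : s ∈ Set.Icc (0 : ℝ) 1) :
    Tendsto (fun n => empiricalMoment p n s) atTop
      (𝓝 (∫ x, |x| ^ p ∂gaussianReal 0 (s * (1 - s)).toNNReal)) := by
  have hclt := tendstoInDistribution_inv_sqrt_mul_sum_sub (P := unifSeq)
    (X := fun k ω => if ω k ≤ s then (1 : ℝ) else 0) (Y := id)
    (P' := gaussianReal 0 (s * (1 - s)).toNNReal)
    ⟨aemeasurable_id, by rw [variance_step hs, Measure.map_id]⟩ (memLp_step s 0)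
    (iIndepFun_unifSeq (measurable_step s)) (identDistrib_unifSeq (measurable_step s))
  simp only [integral_step hs] at hclt
  have hsq : ∀ x : ℝ, (|x| ^ p) ^ 2 = |x| ^ (p * 2) := fun x => by
    rw [Real.rpow_mul (abs_nonneg x), Real.rpow_two]
  have hcont : Continuous fun x : ℝ => |x| ^ p := continuous_abs.rpow_const fun _ => Or.inr hp.le
  have hcont2 : Continuous fun x : ℝ => |x| ^ (p * 2) :=
    continuous_abs.rpow_const fun _ => Or.inr (by positivity)
  have hmom : ∀ n, Integrable (fun ω => |empiricalFluctuation n s ω| ^ (p * 2)) unifSeq ∧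
      ∫ ω, |empiricalFluctuation n s ω| ^ (p * 2) ∂unifSeq ≤ subgaussianMomentBound (p * 2) := by
    intro n
    obtain ⟨c, hc, h⟩ := hasSubgaussianMGF_empiricalFluctuation hs n
    exact integrable_and_integral_abs_rpow_le h hc (by positivity)
  have hv : (s * (1 - s)).toNNReal ≤ 1 := by
    rw [Real.toNNReal_le_one]
    nlinarith [hs.1, hs.2]
  have hg := integrable_and_integral_abs_rpow_le
    (hasSubgaussianMGF_id_gaussianReal (s * (1 - s)).toNNReal) hv (q := p * 2) (by positivity)
  have key := tendsto_integral_of_sq_bounded hclt.tendsto hcont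
    (fun x => Real.rpow_nonneg (abs_nonneg x) p) (C := subgaussianMomentBound (p * 2))
    (fun n => by
      simp only [hsq, ProbabilityMeasure.coe_mk]
      rw [integrable_map_measure hcont2.aestronglyMeasurable (hclt.forall_aemeasurable n)]
      exact (hmom n).1)
    (fun n => by
      simp only [hsq, ProbabilityMeasure.coe_mk]
      rw [integral_map (hclt.forall_aemeasurable n) hcont2.aestronglyMeasurable]
      exact (hmom n).2)
    (by simpa only [hsq, ProbabilityMeasure.coe_mk, Measure.map_id, id_eq] using hg.1)
    (by simpa only [hsq, ProbabilityMeasure.coe_mk, Measure.map_id, id_eq] using hg.2)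
  simp only [ProbabilityMeasure.coe_mk, Measure.map_id] at key
  refine key.congr fun n => ?_
  rw [integral_map (hclt.forall_aemeasurable n) hcont.aestronglyMeasurable]
  rfl

theorem measurable_uncurry_count (n : ℕ) :
    Measurable fun z : (ℕ → ℝ) × ℝ => ∑ k ∈ Finset.range n, if z.1 k ≤ z.2 then (1 : ℝ) else 0 :=
  Finset.measurable_fun_sum _ fun k _ => Measurable.ite
    (measurableSet_le ((measurable_pi_apply k).comp measurable_fst) measurable_snd)
    measurable_const measurable_const

theorem measurable_empiricalFluctuation (n : ℕ) :
    Measurable fun z : (ℕ → ℝ) × ℝ => empiricalFluctuation n z.2 z.1 := by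
  unfold empiricalFluctuation
  have := measurable_uncurry_count n
  fun_prop

theorem measurable_empiricalMoment (p : ℝ) (n : ℕ) : Measurable (empiricalMoment p n) := by
  have h : Measurable fun z : (ℕ → ℝ) × ℝ => |empiricalFluctuation n z.2 z.1| ^ p := by
    have := measurable_empiricalFluctuation n
    fun_prop
  exact h.stronglyMeasurable.integral_prod_left'.measurable

theorem measurable_blueCount (L : ℕ) :
    Measurable fun z : (Fin L → ℝ) × ℝ => blueCount z.1 z.2 :=
  Finset.measurable_fun_sum _ fun k _ => Measurable.ite
    (measurableSet_le ((measurable_pi_apply k).comp measurable_fst) measurable_snd)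
    measurable_const measurable_const

theorem stronglyMeasurable_integral_blueCount (p : ℝ) (L : ℕ) :
    StronglyMeasurable fun b : Fin L → ℝ => ∫ x in (0 : ℝ)..L, |blueCount b x - x| ^ p := by
  simp only [intervalIntegral.integral_of_le (Nat.cast_nonneg L : (0 : ℝ) ≤ L)]
  have h : Measurable fun z : (Fin L → ℝ) × ℝ => |blueCount z.1 z.2 - z.2| ^ p := by
    have := measurable_blueCount L
    fun_prop
  exact h.stronglyMeasurable.integral_prod_right'

/-- The substitution `x = L * s` contributes the factor `L`, the normalisation of the empirical
process contributes `L ^ (p / 2)`, and Fubini exchanges the expectation with the integral over `s`.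
-/
theorem integral_blueLaw_blueCount {p : ℝ} (hp : 0 ≤ p) {L : ℕ} (hL : 0 < L) :
    ∫ b, (∫ x in (0 : ℝ)..L, |blueCount b x - x| ^ p) ∂(blueLaw L L) =
      L * (L : ℝ) ^ (p / 2) * ∫ s in (0 : ℝ)..1, empiricalMoment p L s := by
  have hL' : (0 : ℝ) < L := by exact_mod_cast hL
  have hm := stronglyMeasurable_integral_blueCount p L
  rw [← map_unifSeq_eq_blueLaw hL, integral_map
    (Measurable.aemeasurable (by fun_prop)) hm.aestronglyMeasurable]
  have hcount : ∀ (ω : ℕ → ℝ) (s : ℝ), |blueCount (fun j : Fin L => (L : ℝ) * ω j) (L * s) - L * s| ^ p =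
      (L : ℝ) ^ (p / 2) * |empiricalFluctuation L s ω| ^ p := by
    intro ω s
    have h1 : blueCount (fun j : Fin L => (L : ℝ) * ω j) (L * s) =
        ∑ k ∈ Finset.range L, if ω k ≤ s then (1 : ℝ) else 0 := by
      rw [blueCount, ← Fin.sum_univ_eq_sum_range (fun k => if ω k ≤ s then (1 : ℝ) else 0)]
      simp only [mul_le_mul_iff_right₀ hL']
    have h2 : (L : ℝ) ^ (p / 2) = √L ^ p := by
      rw [Real.sqrt_eq_rpow, ← Real.rpow_mul hL'.le]
      congr 1
      ring
    rw [h1, h2, ← Real.mul_rpow (Real.sqrt_nonneg _) (abs_nonneg _), empiricalFluctuation, abs_mul,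
      abs_of_nonneg (inv_nonneg.2 (Real.sqrt_nonneg _)), mul_inv_cancel_left₀ (Real.sqrt_pos.2 hL').ne']
  have hscale : ∀ ω : ℕ → ℝ,
      ∫ x in (0 : ℝ)..L, |blueCount (fun j : Fin L => (L : ℝ) * ω j) x - x| ^ p =
        L * (L : ℝ) ^ (p / 2) * ∫ s in Set.Ioc (0 : ℝ) 1, |empiricalFluctuation L s ω| ^ p := by
    intro ω
    have := intervalIntegral.smul_integral_comp_mul_left (a := 0) (b := 1)
      (fun x => |blueCount (fun j : Fin L => (L : ℝ) * ω j) x - x| ^ p) (L : ℝ)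
    simp only [mul_zero, mul_one, smul_eq_mul, hcount] at this
    rw [← this, intervalIntegral.integral_const_mul, intervalIntegral.integral_of_le zero_le_one]
    ring
  simp only [hscale]
  rw [integral_const_mul, intervalIntegral.integral_of_le zero_le_one]
  congr 1
  refine integral_integral_swap (f := fun ω s => |empiricalFluctuation L s ω| ^ p) ?_
  have hmeas : Measurable (Function.uncurry fun (ω : ℕ → ℝ) s => |empiricalFluctuation L s ω| ^ p) := by
    have := measurable_empiricalFluctuation L
    simp only [Function.uncurry_def]
    fun_prop
  refine Integrable.of_bound hmeas.aestronglyMeasurable (((√L)⁻¹ * (L + L)) ^ p) ?_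
  have hs : ∀ᵐ s ∂(volume.restrict (Set.Ioc (0 : ℝ) 1)), s ∈ Set.Ioc (0 : ℝ) 1 :=
    ae_restrict_mem measurableSet_Ioc
  filter_upwards [Measure.quasiMeasurePreserving_snd.ae hs] with z hz
  rw [Function.uncurry_def, Real.norm_eq_abs, abs_of_nonneg (Real.rpow_nonneg (abs_nonneg _) _)]
  refine Real.rpow_le_rpow (abs_nonneg _) ?_ hp
  rw [empiricalFluctuation, abs_mul, abs_of_nonneg (inv_nonneg.2 (Real.sqrt_nonneg _))]
  refine mul_le_mul_of_nonneg_left ?_ (inv_nonneg.2 (Real.sqrt_nonneg _))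
  have h1 : ∑ k ∈ Finset.range L, (if z.1 k ≤ z.2 then (1 : ℝ) else 0) ≤ L := by
    simpa using Finset.sum_le_sum fun k (_ : k ∈ Finset.range L) => (step_mem_Icc z.2 (z.1 k)).2
  have h0 : 0 ≤ ∑ k ∈ Finset.range L, (if z.1 k ≤ z.2 then (1 : ℝ) else 0) :=
    Finset.sum_nonneg fun k _ => (step_mem_Icc z.2 (z.1 k)).1
  rw [abs_le]
  constructor <;> nlinarith [hz.1, hz.2]

/-! ### Gaussian moments, the Beta integral and the Brownian bridge -/

/-- The absolute moments of a centred Gaussian variable. -/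
theorem integral_abs_rpow_gaussianReal {p v : ℝ} (hp : 0 < p) (hv : 0 ≤ v) :
    ∫ x, |x| ^ p ∂gaussianReal 0 v.toNNReal =
      (2 * v) ^ (p / 2) / √Real.pi * Real.Gamma ((1 + p) / 2) := by
  -- At variance 0 the Gaussian is a Dirac mass without density; both sides vanish because `p > 0`.
  rcases hv.eq_or_lt with rfl | hv
  · simp [hp.ne', Real.zero_rpow (by positivity : p / 2 ≠ 0)]
  rw [integral_gaussianReal_eq_integral_smul (by simpa using hv)]
  have e : ∀ x : ℝ, gaussianPDFReal 0 v.toNNReal x • |x| ^ p =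
      (√(2 * Real.pi * v))⁻¹ * (|x| ^ p * Real.exp (-(2 * v)⁻¹ * |x| ^ (2 : ℝ))) := fun x => by
    rw [gaussianPDFReal, Real.coe_toNNReal _ hv.le, smul_eq_mul, Real.rpow_two, sq_abs, sub_zero,
      neg_div, div_eq_inv_mul, neg_mul]
    ring
  simp only [e]
  rw [integral_const_mul,
    integral_comp_abs (f := fun x : ℝ => x ^ p * Real.exp (-(2 * v)⁻¹ * x ^ (2 : ℝ))),
    integral_rpow_mul_exp_neg_mul_rpow two_pos (by linarith) (by positivity)]
  have h2v : 0 < 2 * v := by positivity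
  have h1 : ((2 * v)⁻¹ : ℝ) ^ (-(p + 1) / 2) = (2 * v) ^ (p / 2) * √(2 * v) := by
    rw [Real.inv_rpow h2v.le, ← Real.rpow_neg h2v.le, Real.sqrt_eq_rpow, ← Real.rpow_add h2v]
    congr 1
    ring
  have h2 : √(2 * Real.pi * v) = √(2 * v) * √Real.pi := by
    rw [← Real.sqrt_mul h2v.le]
    congr 1
    ring
  have h3 : √(2 * v) ≠ 0 := (Real.sqrt_pos.2 h2v).ne'
  rw [h1, h2, add_comm p 1]
  field_simp

theorem integral_rpow_mul_one_sub_rpow {a : ℝ} (ha : 0 < a) :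
    ∫ s in (0 : ℝ)..1, s ^ a * (1 - s) ^ a = Real.Gamma (a + 1) ^ 2 / Real.Gamma (2 * a + 2) := by
  have hpos : 0 < Real.Gamma (2 * a + 2) := Real.Gamma_pos_of_pos (by positivity)
  rw [eq_div_iff hpos.ne', mul_comm, sq]
  have key := Complex.Gamma_mul_Gamma_eq_betaIntegral (s := ((a + 1 : ℝ) : ℂ))
    (t := ((a + 1 : ℝ) : ℂ)) (by simp; linarith) (by simp; linarith)
  have e : Complex.betaIntegral ((a + 1 : ℝ) : ℂ) ((a + 1 : ℝ) : ℂ) =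
      ((∫ s in (0 : ℝ)..1, s ^ a * (1 - s) ^ a : ℝ) : ℂ) := by
    rw [Complex.betaIntegral, ← intervalIntegral.integral_ofReal]
    refine intervalIntegral.integral_congr fun s hs => ?_
    rw [Set.uIcc_of_le zero_le_one] at hs
    rw [Complex.ofReal_mul, Complex.ofReal_cpow hs.1, Complex.ofReal_cpow (by linarith [hs.2])]
    push_cast
    ring_nf
  rw [e, ← Complex.ofReal_add, Complex.Gamma_ofReal, Complex.Gamma_ofReal] at key
  have := (Complex.ofReal_injective (by push_cast; exact key) :
    Real.Gamma (a + 1) * Real.Gamma (a + 1) = Real.Gamma (a + 1 + (a + 1)) *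
      ∫ s in (0 : ℝ)..1, s ^ a * (1 - s) ^ a)
  rw [this, show a + 1 + (a + 1) = 2 * a + 2 by ring]

theorem integral_gaussian_moment {p : ℝ} (hp : 0 < p) :
    (∫ s in (0 : ℝ)..1,
        (2 * s * (1 - s)) ^ (p / 2) / √Real.pi * Real.Gamma ((1 + p) / 2)) =
      √((2 : ℝ) ^ p / Real.pi) * (Real.Gamma (p / 2 + 1) ^ 2 / Real.Gamma (p + 2)) *
        Real.Gamma ((1 + p) / 2) := by
  have e : ∀ s ∈ Set.uIcc (0 : ℝ) 1,
      (2 * s * (1 - s)) ^ (p / 2) / √Real.pi * Real.Gamma ((1 + p) / 2) =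
        (2 ^ (p / 2) / √Real.pi * Real.Gamma ((1 + p) / 2)) * (s ^ (p / 2) * (1 - s) ^ (p / 2)) := by
    intro s hs
    rw [Set.uIcc_of_le zero_le_one] at hs
    rw [Real.mul_rpow (by linarith [hs.1]) (by linarith [hs.2]), Real.mul_rpow two_pos.le hs.1]
    ring
  rw [intervalIntegral.integral_congr e, intervalIntegral.integral_const_mul,
    integral_rpow_mul_one_sub_rpow (by positivity), Real.sqrt_div (by positivity),
    Real.sqrt_eq_rpow (2 ^ p), ← Real.rpow_mul two_pos.le,
    show 2 * (p / 2) + 2 = p + 2 by ring, show p * (1 / 2) = p / 2 by ring]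
  ring

/-- Legendre's duplication formula at `(1 + p) / 2` turns one Gamma factor of order `p / 2 + 1` and
the factor `(1 + p) / 2` into `Γ(p + 1)`, which cancels against `Γ(p + 2) = (p + 1) Γ(p + 1)`. -/
theorem gaussian_moment_eq {p : ℝ} (hp : 0 < p) :
    √((2 : ℝ) ^ p / Real.pi) * (Real.Gamma (p / 2 + 1) ^ 2 / Real.Gamma (p + 2)) *
        Real.Gamma ((1 + p) / 2) =
      (2 : ℝ) ^ (-p / 2) * Real.Gamma (p / 2 + 1) / (p + 1) := by
  have h1 : Real.Gamma (p + 2) = (p + 1) * Real.Gamma (p + 1) := by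
    rw [← Real.Gamma_add_one (by positivity)]
    ring_nf
  have h2 := Real.Gamma_mul_Gamma_add_half ((1 + p) / 2)
  rw [show (1 + p) / 2 + 1 / 2 = p / 2 + 1 by ring, show 2 * ((1 + p) / 2) = p + 1 by ring,
    show 1 - (p + 1) = -p / 2 + -p / 2 by ring, Real.rpow_add two_pos] at h2
  have h3 : √((2 : ℝ) ^ p / Real.pi) * (2 : ℝ) ^ (-p / 2) * √Real.pi = 1 := by
    rw [Real.sqrt_div (by positivity), Real.sqrt_eq_rpow (2 ^ p), ← Real.rpow_mul two_pos.le,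
      div_mul_eq_mul_div, div_mul_cancel₀ _ (Real.sqrt_pos.2 Real.pi_pos).ne',
      ← Real.rpow_add two_pos, show p * (1 / 2) + -p / 2 = 0 by ring, Real.rpow_zero]
  have hG : Real.Gamma (p + 1) ≠ 0 := (Real.Gamma_pos_of_pos (by positivity)).ne'
  have hp1 : p + 1 ≠ 0 := by positivity
  rw [h1]
  calc _ = √((2 : ℝ) ^ p / Real.pi) * (Real.Gamma ((1 + p) / 2) * Real.Gamma (p / 2 + 1)) *
        Real.Gamma (p / 2 + 1) / ((p + 1) * Real.Gamma (p + 1)) := by ring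
    _ = (√((2 : ℝ) ^ p / Real.pi) * (2 : ℝ) ^ (-p / 2) * √Real.pi) *
        ((2 : ℝ) ^ (-p / 2) * Real.Gamma (p / 2 + 1)) *
          (Real.Gamma (p + 1) / ((p + 1) * Real.Gamma (p + 1))) := by rw [h2]; ring
    _ = _ := by rw [h3]; field_simp

theorem IsBrownianBridge.map_eq {Ω : Type*} [MeasurableSpace Ω] {P : Measure Ω}
    {B : unitInterval → Ω → ℝ} (hB : IsBrownianBridge B P) (s : unitInterval) :
    P.map (B s) = gaussianReal 0 ((s : ℝ) * (1 - s)).toNNReal := by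
  have h := hB.gaussian.hasGaussianLaw_eval s
  rw [h.map_eq_gaussianReal, hB.mean, ← covariance_self h.aemeasurable, hB.covariance, min_self]
  congr 2
  ring

theorem IsBrownianBridge.integral_abs_rpow {Ω : Type*} [MeasurableSpace Ω] {P : Measure Ω}
    {B : unitInterval → Ω → ℝ} (hB : IsBrownianBridge B P) {p : ℝ} (hp : 0 < p) (s : unitInterval) :
    Integrable (fun ω => |B s ω| ^ p) P ∧ ∫ ω, |B s ω| ^ p ∂P =
      (2 * s * (1 - s)) ^ (p / 2) / √Real.pi * Real.Gamma ((1 + p) / 2) := by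
  have hm := (hB.gaussian.hasGaussianLaw_eval s).aemeasurable
  have hc : Continuous fun x : ℝ => |x| ^ p := continuous_abs.rpow_const fun _ => Or.inr hp.le
  have hv : 0 ≤ (s : ℝ) * (1 - s) := mul_nonneg s.2.1 (by linarith [s.2.2])
  have hv1 : ((s : ℝ) * (1 - s)).toNNReal ≤ 1 := by
    rw [Real.toNNReal_le_one]
    nlinarith [s.2.1, s.2.2]
  constructor
  · have := (integrable_and_integral_abs_rpow_le
      (hasSubgaussianMGF_id_gaussianReal ((s : ℝ) * (1 - s)).toNNReal) hv1 hp.le).1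
    rw [← hB.map_eq s] at this
    exact (integrable_map_measure hc.aestronglyMeasurable hm).1 this
  · have := integral_map (μ := P) hm (f := fun x : ℝ => |x| ^ p) hc.aestronglyMeasurable
    rw [← this, hB.map_eq s, integral_abs_rpow_gaussianReal hp hv, mul_assoc]

theorem IsBrownianBridge.integral_integral_abs_rpow {Ω : Type*} [MeasurableSpace Ω] {P : Measure Ω}
    {B : unitInterval → Ω → ℝ} (hB : IsBrownianBridge B P) {p : ℝ} (hp : 0 < p) :
    Integrable (fun s : unitInterval => ∫ ω, |B s ω| ^ p ∂P) ∧
      (∫ s : unitInterval, ∫ ω, |B s ω| ^ p ∂P) =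
        ∫ s in (0 : ℝ)..1,
          (2 * s * (1 - s)) ^ (p / 2) / √Real.pi * Real.Gamma ((1 + p) / 2) := by
  simp only [fun s => (hB.integral_abs_rpow hp s).2]
  constructor
  · have hc : Continuous fun s : unitInterval =>
        (2 * (s : ℝ) * (1 - s)) ^ (p / 2) / √Real.pi * Real.Gamma ((1 + p) / 2) := by
      refine Continuous.mul_const (Continuous.div_const (Continuous.rpow_const (by fun_prop)
        fun _ => Or.inr (by positivity)) _) _
    exact hc.integrable_of_hasCompactSupport (HasCompactSupport.of_compactSpace _)
  · rw [intervalIntegral.integral_of_le zero_le_one, ← integral_Icc_eq_integral_Ioc]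
    exact integral_subtype_comap measurableSet_Icc fun s : ℝ =>
      (2 * s * (1 - s)) ^ (p / 2) / √Real.pi * Real.Gamma ((1 + p) / 2)

/-! ### Measurability and integrability of the costs -/

instance (L M : ℕ) : IsFiniteMeasure (blueLaw L M) := by unfold blueLaw; infer_instance

theorem ae_blueLaw_mem_Icc (L M : ℕ) : ∀ᵐ b ∂(blueLaw L M), ∀ i, b i ∈ Set.Icc (0 : ℝ) L := by
  refine ae_all_iff.2 fun i => ?_
  have h : ∀ᵐ x ∂(ProbabilityTheory.cond volume (Set.Icc (0 : ℝ) L)), x ∈ Set.Icc (0 : ℝ) L :=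
    ae_cond_mem measurableSet_Icc
  exact (Measure.tendsto_eval_ae_ae (μ := fun _ : Fin M =>
    ProbabilityTheory.cond volume (Set.Icc (0 : ℝ) L)) (i := i)).eventually h

theorem measurable_optimalCost {N M : ℕ} {α : Type*} [MeasurableSpace α]
    {w : α → Fin N → Fin M → ℝ} (hw : ∀ i j, Measurable fun a => w a i j) :
    Measurable fun a => optimalCost (w a) :=
  Measurable.iInf fun _ => Finset.measurable_fun_sum _ fun _ _ => hw _ _

theorem measurable_criticalOpenCost (p : ℝ) (L : ℕ) : Measurable (criticalOpenCost p L) :=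
  measurable_optimalCost fun i j => by fun_prop

theorem measurable_criticalPeriodicCost (p : ℝ) (L : ℕ) : Measurable (criticalPeriodicCost p L) :=
  measurable_optimalCost fun i j => by
    have : Measurable fun b : Fin L → ℝ => periodicDist L (redPoint i) (b j) :=
      Measurable.iInf fun ν => by fun_prop
    exact this.pow_const p

theorem optimalCost_nonneg {N M : ℕ} (h : N ≤ M) {w : Fin N → Fin M → ℝ} (hw : ∀ i j, 0 ≤ w i j) :
    0 ≤ optimalCost w := by
  obtain ⟨⟨π, hπ⟩, -⟩ := exists_matchingCost_eq_optimalCost h w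
  rw [← hπ]
  exact Finset.sum_nonneg fun i _ => hw _ _

theorem optimalCost_le_of_forall_le {n : ℕ} {w : Fin n → Fin n → ℝ} {C : ℝ}
    (hw : ∀ i j, w i j ≤ C) : optimalCost w ≤ n * C := by
  refine ((exists_matchingCost_eq_optimalCost le_rfl w).2 (Function.Embedding.refl _)).trans ?_
  simpa [matchingCost] using Finset.sum_le_sum fun i (_ : i ∈ Finset.univ) => hw i i

theorem abs_sub_redPoint_le {L : ℕ} {x : ℝ} (hx : x ∈ Set.Icc (0 : ℝ) L) (i : Fin L) :
    |x - redPoint i| ≤ L := by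
  have h1 : ((i : ℕ) : ℝ) + 1 ≤ L := by exact_mod_cast i.2
  have h0 : (0 : ℝ) ≤ (i : ℕ) := Nat.cast_nonneg _
  rw [redPoint, abs_le]
  constructor <;> linarith [hx.1, hx.2]

theorem integrable_criticalOpenCost {p : ℝ} (hp : 0 ≤ p) (L : ℕ) :
    Integrable (criticalOpenCost p L) (blueLaw L L) := by
  refine Integrable.of_bound (measurable_criticalOpenCost p L).aestronglyMeasurable
    (L * (L : ℝ) ^ p) ?_
  filter_upwards [ae_blueLaw_mem_Icc L L] with b hb
  have h0 : 0 ≤ criticalOpenCost p L b :=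
    optimalCost_nonneg le_rfl fun i j => Real.rpow_nonneg (abs_nonneg _) _
  rw [Real.norm_eq_abs, abs_of_nonneg h0]
  exact optimalCost_le_of_forall_le fun i j =>
    Real.rpow_le_rpow (abs_nonneg _) (abs_sub_redPoint_le (hb j) i) hp

theorem integrable_criticalPeriodicCost {p : ℝ} (hp : 0 ≤ p) (L : ℕ) :
    Integrable (criticalPeriodicCost p L) (blueLaw L L) := by
  refine Integrable.of_bound (measurable_criticalPeriodicCost p L).aestronglyMeasurable
    (L * (L : ℝ) ^ p) ?_
  filter_upwards [ae_blueLaw_mem_Icc L L] with b hb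
  have h0 : 0 ≤ criticalPeriodicCost p L b :=
    optimalCost_nonneg le_rfl fun i j => Real.rpow_nonneg (periodicDist_nonneg _ _ _) _
  rw [Real.norm_eq_abs, abs_of_nonneg h0]
  refine optimalCost_le_of_forall_le fun i j =>
    Real.rpow_le_rpow (periodicDist_nonneg _ _ _) ?_ hp
  have := periodicDist_le L (redPoint i) (b j) 0
  rw [Int.cast_zero, zero_mul, sub_zero] at this
  exact this.trans (abs_sub_redPoint_le (hb j) i)

/-! ### The open limit -/

/-- Dominated convergence over `s`, the dominating function being the constant sub-Gaussian moment
bound. -/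
theorem tendsto_integral_empiricalMoment {p : ℝ} (hp : 0 < p) :
    Tendsto (fun n => ∫ s in (0 : ℝ)..1, empiricalMoment p n s) atTop
      (𝓝 ((2 : ℝ) ^ (-p / 2) * Real.Gamma (p / 2 + 1) / (p + 1))) := by
  rw [← gaussian_moment_eq hp, ← integral_gaussian_moment hp]
  refine intervalIntegral.tendsto_integral_filter_of_dominated_convergence
    (fun _ => subgaussianMomentBound p) (Eventually.of_forall fun n =>
      (measurable_empiricalMoment p n).aestronglyMeasurable) ?_ (by simp) ?_
  · refine Eventually.of_forall fun n => ae_of_all _ fun s hs => ?_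
    rw [Set.uIoc_of_le zero_le_one] at hs
    rw [Real.norm_eq_abs, abs_of_nonneg (empiricalMoment_nonneg _ _ _)]
    exact empiricalMoment_le hp.le ⟨hs.1.le, hs.2⟩ n
  · refine ae_of_all _ fun s hs => ?_
    rw [Set.uIoc_of_le zero_le_one] at hs
    have := tendsto_empiricalMoment hp (s := s) ⟨hs.1.le, hs.2⟩
    rwa [integral_abs_rpow_gaussianReal hp (mul_nonneg hs.1.le (by linarith [hs.2])),
      ← mul_assoc] at this

theorem integrable_integral_blueCount {p : ℝ} (hp : 0 ≤ p) (L : ℕ) :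
    Integrable (fun b : Fin L → ℝ => ∫ x in (0 : ℝ)..L, |blueCount b x - x| ^ p) (blueLaw L L) := by
  have hL' : (0 : ℝ) ≤ L := Nat.cast_nonneg L
  have hm := stronglyMeasurable_integral_blueCount p L
  refine Integrable.of_bound hm.aestronglyMeasurable ((L : ℝ) ^ p * |(L : ℝ) - 0|)
    (ae_of_all _ fun b => intervalIntegral.norm_integral_le_of_norm_le_const fun x hx => ?_)
  rw [Set.uIoc_of_le hL'] at hx
  rw [Real.norm_eq_abs, abs_of_nonneg (Real.rpow_nonneg (abs_nonneg _) _)]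
  refine Real.rpow_le_rpow (abs_nonneg _) ?_ hp
  have h1 : blueCount b x ≤ L := by
    refine (Finset.sum_le_sum fun k _ => (step_mem_Icc x (b k)).2).trans ?_
    simp
  have h0 : 0 ≤ blueCount b x := Finset.sum_nonneg fun k _ => (step_mem_Icc x (b k)).1
  rw [abs_le]
  constructor <;> linarith [hx.1, hx.2]

/-- The pathwise comparison is integrated with `t = L ^ (-1/2)`. After scaling, the error `L ^
(-p/2) * t ^ (1 - p)` equals `t` itself, and the prefactor `(1 - t) ^ (1 - p)` tends to 1, so the
two bounds squeeze. The condition `1 < L` ensures `t < 1`. -/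
theorem integral_criticalOpenCost_comparison {p : ℝ} (hp : 1 ≤ p) {L : ℕ} (hL : 1 < L) :
    (L : ℝ) ^ (-p / 2) * ((L : ℝ)⁻¹ * ∫ b, criticalOpenCost p L b ∂(blueLaw L L)) ≤
        (1 - (√L)⁻¹) ^ (1 - p) * (∫ s in (0 : ℝ)..1, empiricalMoment p L s) + (√L)⁻¹ ∧
      ∫ s in (0 : ℝ)..1, empiricalMoment p L s ≤ (1 - (√L)⁻¹) ^ (1 - p) *
        ((L : ℝ) ^ (-p / 2) * ((L : ℝ)⁻¹ * ∫ b, criticalOpenCost p L b ∂(blueLaw L L))) +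
          (√L)⁻¹ := by
  have hL0 : (0 : ℝ) < L := by positivity
  have hL1 : (1 : ℝ) < L := by exact_mod_cast hL
  have hs1 : 1 < √L := Real.lt_sqrt_of_sq_lt (by simpa using hL1)
  set t := (√(L : ℝ))⁻¹ with ht
  have ht0 : 0 < t := by positivity
  have ht1 : t < 1 := inv_lt_one_of_one_lt₀ hs1
  have hprob : IsProbabilityMeasure (blueLaw L L) := by
    rw [← map_unifSeq_eq_blueLaw (by omega : 0 < L)]
    exact Measure.isProbabilityMeasure_map (Measurable.aemeasurable (by fun_prop))
  have i1 := integrable_criticalOpenCost (by linarith : 0 ≤ p) L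
  have i2 := integrable_integral_blueCount (by linarith : 0 ≤ p) L
  set X := ∫ b, criticalOpenCost p L b ∂(blueLaw L L) with hX
  set Y := ∫ s in (0 : ℝ)..1, empiricalMoment p L s with hY
  have hYe := integral_blueLaw_blueCount (by linarith : 0 ≤ p) (by omega : 0 < L)
  rw [← hY] at hYe
  set c := (1 - t) ^ (1 - p) with hc
  have e1 : X ≤ c * (L * (L : ℝ) ^ (p / 2) * Y) + L * t ^ (1 - p) := by
    rw [← hYe, ← integral_const_mul]
    have := integral_mono_ae i1 ((i2.const_mul c).add (integrable_const (L * t ^ (1 - p)))) (by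
      filter_upwards [ae_blueLaw_mem_Icc L L] with b hb
      exact (criticalOpenCost_comparison hp ht0 ht1 b hb).1)
    simp only [Pi.add_apply] at this
    rw [integral_add (i2.const_mul c) (integrable_const _)] at this
    simpa using this
  have e2 : L * (L : ℝ) ^ (p / 2) * Y ≤ c * X + L * t ^ (1 - p) := by
    rw [← hYe, hX, ← integral_const_mul]
    have := integral_mono_ae i2 ((i1.const_mul c).add (integrable_const (L * t ^ (1 - p)))) (by
      filter_upwards [ae_blueLaw_mem_Icc L L] with b hb
      exact (criticalOpenCost_comparison hp ht0 ht1 b hb).2)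
    simp only [Pi.add_apply] at this
    rw [integral_add (i1.const_mul c) (integrable_const _)] at this
    simpa using this
  have hpow : (L : ℝ) ^ (-p / 2) * (L : ℝ) ^ (p / 2) = 1 := by
    rw [← Real.rpow_add hL0, show -p / 2 + p / 2 = 0 by ring, Real.rpow_zero]
  have herr : (L : ℝ) ^ (-p / 2) * t ^ (1 - p) = t := by
    have : t = (L : ℝ) ^ (-(1 / 2) : ℝ) := by
      rw [ht, Real.sqrt_eq_rpow, Real.rpow_neg hL0.le]
    rw [this, ← Real.rpow_mul hL0.le, ← Real.rpow_add hL0]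
    congr 1
    ring
  have hk : 0 ≤ (L : ℝ) ^ (-p / 2) * (L : ℝ)⁻¹ := by positivity
  have hcancel : (L : ℝ)⁻¹ * L = 1 := inv_mul_cancel₀ hL0.ne'
  have f1 := mul_le_mul_of_nonneg_left e1 hk
  have f2 := mul_le_mul_of_nonneg_left e2 hk
  have g1 : (L : ℝ) ^ (-p / 2) * (L : ℝ)⁻¹ * (c * (L * (L : ℝ) ^ (p / 2) * Y) + L * t ^ (1 - p)) =
      c * Y + t := by
    calc _ = c * Y * ((L : ℝ)⁻¹ * L) * ((L : ℝ) ^ (-p / 2) * (L : ℝ) ^ (p / 2)) +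
          ((L : ℝ)⁻¹ * L) * ((L : ℝ) ^ (-p / 2) * t ^ (1 - p)) := by ring
      _ = _ := by rw [hpow, herr, hcancel]; ring
  have g2 : (L : ℝ) ^ (-p / 2) * (L : ℝ)⁻¹ * (L * (L : ℝ) ^ (p / 2) * Y) = Y := by
    calc _ = Y * ((L : ℝ)⁻¹ * L) * ((L : ℝ) ^ (-p / 2) * (L : ℝ) ^ (p / 2)) := by ring
      _ = _ := by rw [hpow, hcancel]; ring
  have g3 : (L : ℝ) ^ (-p / 2) * (L : ℝ)⁻¹ * (c * X + L * t ^ (1 - p)) =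
      c * ((L : ℝ) ^ (-p / 2) * ((L : ℝ)⁻¹ * X)) + t := by
    calc _ = c * ((L : ℝ) ^ (-p / 2) * ((L : ℝ)⁻¹ * X)) +
          ((L : ℝ)⁻¹ * L) * ((L : ℝ) ^ (-p / 2) * t ^ (1 - p)) := by ring
      _ = _ := by rw [herr, hcancel]; ring
  rw [g1, mul_assoc] at f1
  rw [g2, g3] at f2
  exact ⟨f1, f2⟩

theorem tendsto_mean_criticalOpenCost {p : ℝ} (hp : 1 ≤ p) :
    Tendsto (fun L : ℕ => (L : ℝ) ^ (-p / 2) *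
        ((L : ℝ)⁻¹ * ∫ b, criticalOpenCost p L b ∂(blueLaw L L)))
      atTop (𝓝 ((2 : ℝ) ^ (-p / 2) * Real.Gamma (p / 2 + 1) / (p + 1))) := by
  have ht : Tendsto (fun L : ℕ => (√(L : ℝ))⁻¹) atTop (𝓝 0) :=
    tendsto_inv_atTop_zero.comp (Real.tendsto_sqrt_atTop.comp tendsto_natCast_atTop_atTop)
  have hc : Tendsto (fun L : ℕ => (1 - (√(L : ℝ))⁻¹) ^ (1 - p)) atTop (𝓝 1) := by
    have := (ht.const_sub 1).rpow_const (p := 1 - p) (Or.inl (by norm_num))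
    simpa using this
  have hY := tendsto_integral_empiricalMoment (by linarith : 0 < p)
  have hup := (hc.mul hY).add ht
  have hlow := (hY.sub ht).div hc one_ne_zero
  rw [one_mul, add_zero] at hup
  rw [sub_zero, div_one] at hlow
  refine tendsto_of_tendsto_of_tendsto_of_le_of_le' hlow hup ?_ ?_
  · filter_upwards [eventually_gt_atTop 1] with L hL
    have hL1 : (1 : ℝ) < L := by exact_mod_cast hL
    have hs1 : 1 < √(L : ℝ) := Real.lt_sqrt_of_sq_lt (by simpa using hL1)
    have hpos : 0 < (1 - (√(L : ℝ))⁻¹) ^ (1 - p) :=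
      Real.rpow_pos_of_pos (sub_pos.2 (inv_lt_one_of_one_lt₀ hs1)) _
    rw [Pi.div_apply, div_le_iff₀ hpos]
    have := (integral_criticalOpenCost_comparison hp hL).2
    linarith
  · filter_upwards [eventually_gt_atTop 1] with L hL
    exact (integral_criticalOpenCost_comparison hp hL).1

theorem tendsto_mean_criticalOpenCost_two :
    Tendsto (fun L : ℕ => (L : ℝ)⁻¹ * ((L : ℝ)⁻¹ * ∫ b, criticalOpenCost 2 L b ∂(blueLaw L L)))
      atTop (𝓝 (1 / 6)) := by
  have h := tendsto_mean_criticalOpenCost (p := 2) (by norm_num)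
  have e : (2 : ℝ) ^ (-2 / 2 : ℝ) * Real.Gamma (2 / 2 + 1) / (2 + 1) = 1 / 6 := by
    rw [show (-2 / 2 : ℝ) = -1 by norm_num, show (2 / 2 + 1 : ℝ) = 2 by norm_num, Real.Gamma_two,
      Real.rpow_neg_one]
    norm_num
  rw [e] at h
  refine h.congr fun L => ?_
  rw [show (-2 / 2 : ℝ) = -1 by norm_num, Real.rpow_neg_one]

/-! ### The periodic limit -/

/-- The subtracted constant is the mean of the sum of the blue points, so this is a variance: `L`
independent terms, each uniform on an interval of length `L` with variance `L² / 12`. -/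
theorem integral_sum_displacement_sq {L : ℕ} (hL : 0 < L) :
    Integrable (fun b => (∑ i, displacement b i) ^ 2) (blueLaw L L) ∧
      ∫ b, (∑ i, displacement b i) ^ 2 ∂(blueLaw L L) = (L : ℝ) ^ 3 / 12 := by
  simp only [sum_displacement]
  have hm : Measurable fun b : Fin L → ℝ => (∑ i, b i - (L : ℝ) ^ 2 / 2) ^ 2 := by fun_prop
  constructor
  · refine Integrable.of_bound hm.aestronglyMeasurable (((L : ℝ) * L + (L : ℝ) ^ 2 / 2) ^ 2) ?_
    filter_upwards [ae_blueLaw_mem_Icc L L] with b hb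
    rw [Real.norm_eq_abs, abs_of_nonneg (sq_nonneg _)]
    have h0 : 0 ≤ ∑ i, b i := Finset.sum_nonneg fun i _ => (hb i).1
    have h1 : ∑ i, b i ≤ L * L := by
      simpa using Finset.sum_le_sum fun i (_ : i ∈ Finset.univ) => (hb i).2
    exact sq_le_sq' (by nlinarith) (by nlinarith [sq_nonneg (L : ℝ)])
  rw [← map_unifSeq_eq_blueLaw hL, integral_map (Measurable.aemeasurable (by fun_prop))
    hm.aestronglyMeasurable]
  set Y : ℕ → (ℕ → ℝ) → ℝ := fun k ω => (L : ℝ) * ω k with hY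
  have hident := identDistrib_unifSeq (X := fun x => (L : ℝ) * x) (by fun_prop)
  have hmean : ∀ k, ∫ ω, Y k ω ∂unifSeq = L / 2 := fun k => by
    rw [hY, integral_unifSeq_eval (X := fun x => (L : ℝ) * x) (by fun_prop),
      intervalIntegral.integral_const_mul, integral_id]
    ring
  have hae : ∀ k, ∀ᵐ ω ∂unifSeq, Y k ω ∈ Set.Icc (0 : ℝ) L := fun k => by
    have h : ∀ᵐ x ∂unifIcc, x ∈ Set.Icc (0 : ℝ) 1 := ae_restrict_mem measurableSet_Icc
    rw [← unifSeq_map_eval k] at h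
    filter_upwards [ae_of_ae_map (measurable_pi_apply k).aemeasurable h] with ω hω
    exact ⟨by have := hω.1; positivity, mul_le_of_le_one_right (Nat.cast_nonneg L) hω.2⟩
  have hLp : ∀ k, MemLp (Y k) 2 unifSeq := fun k =>
    memLp_of_bounded (hae k) (Measurable.aestronglyMeasurable (by fun_prop)) 2
  have hvar : ∀ k, variance (Y k) unifSeq = (L : ℝ) ^ 2 / 12 := fun k => by
    rw [variance_eq_sub (hLp k), hmean]
    have : ∫ ω, (Y k ^ 2) ω ∂unifSeq = (L : ℝ) ^ 2 / 3 := by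
      simp only [hY, Pi.pow_apply, mul_pow]
      rw [integral_unifSeq_eval (X := fun x => (L : ℝ) ^ 2 * x ^ 2) (by fun_prop),
        intervalIntegral.integral_const_mul, integral_pow]
      norm_num
      ring
    rw [this]
    ring
  have hind := iIndepFun_unifSeq (X := fun x => (L : ℝ) * x) (by fun_prop)
  have hsum := IndepFun.variance_sum (X := Y) (s := Finset.range L) (fun i _ => hLp i)
    (fun i _ j _ hij => hind.indepFun hij)
  rw [variance_eq_integral (Measurable.aemeasurable (by fun_prop))] at hsum
  simp only [hvar, Finset.sum_apply] at hsum
  rw [integral_finsetSum _ fun i _ => (hLp i).integrable (by norm_num)] at hsum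
  simp only [hmean, Finset.sum_const, Finset.card_range, nsmul_eq_mul] at hsum
  have e : ∀ ω : ℕ → ℝ, ∑ i : Fin L, (L : ℝ) * ω i = ∑ i ∈ Finset.range L, Y i ω := fun ω =>
    Fin.sum_univ_eq_sum_range (fun i => (L : ℝ) * ω i) L
  simp only [e]
  rw [show (L : ℝ) ^ 2 / 2 = L * (L / 2) by ring, hsum]
  ring

/-- Centring the displacements removes `L² / 12` on average, which is 1/12 after dividing by `L²`;
the rounding error `L / 4` of the rotation becomes `1 / (4 L)`. -/
theorem mean_criticalPeriodicCost_bounds {L : ℕ} (hL : 0 < L) :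
    (L : ℝ)⁻¹ * ((L : ℝ)⁻¹ * ∫ b, criticalOpenCost 2 L b ∂(blueLaw L L)) - 1 / 12 ≤
        (L : ℝ)⁻¹ * ((L : ℝ)⁻¹ * ∫ b, criticalPeriodicCost 2 L b ∂(blueLaw L L)) ∧
      (L : ℝ)⁻¹ * ((L : ℝ)⁻¹ * ∫ b, criticalPeriodicCost 2 L b ∂(blueLaw L L)) ≤
        (L : ℝ)⁻¹ * ((L : ℝ)⁻¹ * ∫ b, criticalOpenCost 2 L b ∂(blueLaw L L)) - 1 / 12 +
          (L : ℝ)⁻¹ / 4 := by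
  have hL0 : (0 : ℝ) < L := by exact_mod_cast hL
  have hprob : IsProbabilityMeasure (blueLaw L L) := by
    rw [← map_unifSeq_eq_blueLaw hL]
    exact Measure.isProbabilityMeasure_map (Measurable.aemeasurable (by fun_prop))
  have i1 := integrable_criticalOpenCost two_pos.le L
  have i2 := integrable_criticalPeriodicCost two_pos.le L
  obtain ⟨i3, hD⟩ := integral_sum_displacement_sq hL
  have i4 : Integrable (fun b => criticalOpenCost 2 L b - (∑ i, displacement b i) ^ 2 / L)
      (blueLaw L L) := i1.sub (i3.div_const L)
  have hV : ∫ b, (criticalOpenCost 2 L b - (∑ i, displacement b i) ^ 2 / L) ∂(blueLaw L L) =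
      ∫ b, criticalOpenCost 2 L b ∂(blueLaw L L) - (L : ℝ) ^ 2 / 12 := by
    rw [integral_sub i1 (i3.div_const L), integral_div, hD]
    field_simp
  have e1 := integral_mono_ae i4 i2 (by
    filter_upwards [ae_blueLaw_mem_Icc L L] with b hb
    have := le_criticalPeriodicCost hL b hb
    rwa [sum_displacement_sq] at this)
  have e2 := integral_mono i2 (i4.add (integrable_const ((L : ℝ) / 4))) fun b => by
    have := criticalPeriodicCost_le hL b
    rwa [sum_displacement_sq] at this
  simp only [Pi.add_apply] at e2
  rw [integral_add i4 (integrable_const _)] at e2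
  rw [hV] at e1 e2
  simp only [integral_const, probReal_univ, one_smul] at e2
  set X := ∫ b, criticalOpenCost 2 L b ∂(blueLaw L L)
  set Z := ∫ b, criticalPeriodicCost 2 L b ∂(blueLaw L L)
  have hk : 0 ≤ (L : ℝ)⁻¹ * (L : ℝ)⁻¹ := by positivity
  have f1 := mul_le_mul_of_nonneg_left e1 hk
  have f2 := mul_le_mul_of_nonneg_left e2 hk
  have g : (L : ℝ)⁻¹ * (L : ℝ)⁻¹ * (X - (L : ℝ) ^ 2 / 12) = (L : ℝ)⁻¹ * ((L : ℝ)⁻¹ * X) - 1 / 12 := by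
    field_simp
  have g' : (L : ℝ)⁻¹ * (L : ℝ)⁻¹ * (L / 4) = (L : ℝ)⁻¹ / 4 := by field_simp
  rw [g, mul_assoc] at f1
  rw [mul_add, g, g', mul_assoc] at f2
  exact ⟨f1, f2⟩

theorem tendsto_mean_criticalPeriodicCost :
    Tendsto (fun L : ℕ => (L : ℝ)⁻¹ *
        ((L : ℝ)⁻¹ * ∫ b, criticalPeriodicCost 2 L b ∂(blueLaw L L)))
      atTop (𝓝 (1 / 12)) := by
  have hlow := tendsto_mean_criticalOpenCost_two.sub_const (1 / 12)
  have hinv : Tendsto (fun L : ℕ => (L : ℝ)⁻¹ / 4) atTop (𝓝 (0 / 4)) :=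
    (tendsto_inv_atTop_zero.comp tendsto_natCast_atTop_atTop).div_const 4
  have hup := hlow.add hinv
  rw [show (1 / 6 - 1 / 12 + 0 / 4 : ℝ) = 1 / 12 by norm_num] at hup
  rw [show (1 / 6 - 1 / 12 : ℝ) = 1 / 12 by norm_num] at hlow
  refine tendsto_of_tendsto_of_tendsto_of_le_of_le' hlow hup ?_ ?_
  · filter_upwards [eventually_gt_atTop 0] with L hL
    exact (mean_criticalPeriodicCost_bounds hL).1
  · filter_upwards [eventually_gt_atTop 0] with L hL
    exact (mean_criticalPeriodicCost_bounds hL).2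

end GridPoisson

theorem mainTheorem6 :
    -- open boundary conditions, any exponent greater than 1
    (∀ p : ℝ, 1 < p →
      (∀ L : ℕ, Integrable (GridPoisson.criticalOpenCost p L) (GridPoisson.blueLaw L L)) ∧
      Tendsto (fun L : ℕ => (L : ℝ) ^ (-p / 2) *
          ((L : ℝ)⁻¹ * ∫ b, GridPoisson.criticalOpenCost p L b ∂(GridPoisson.blueLaw L L)))
        atTop (𝓝 ((2 : ℝ) ^ (-p / 2) * Real.Gamma (p / 2 + 1) / (p + 1))) ∧
      (∫ s in (0 : ℝ)..1,
          (2 * s * (1 - s)) ^ (p / 2) / √Real.pi * Real.Gamma ((1 + p) / 2)) =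
        √((2 : ℝ) ^ p / Real.pi) * (Real.Gamma (p / 2 + 1) ^ 2 / Real.Gamma (p + 2)) *
          Real.Gamma ((1 + p) / 2) ∧
      √((2 : ℝ) ^ p / Real.pi) * (Real.Gamma (p / 2 + 1) ^ 2 / Real.Gamma (p + 2)) *
          Real.Gamma ((1 + p) / 2) =
        (2 : ℝ) ^ (-p / 2) * Real.Gamma (p / 2 + 1) / (p + 1) ∧
      -- the limit is the integrated absolute moment of a Brownian bridge
      ∀ (Ω : Type*) [MeasurableSpace Ω] (P : Measure Ω) (B : unitInterval → Ω → ℝ),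
        GridPoisson.IsBrownianBridge B P →
        (∀ s, Integrable (fun ω => |B s ω| ^ p) P) ∧
        Integrable (fun s : unitInterval => ∫ ω, |B s ω| ^ p ∂P) ∧
        (∫ s : unitInterval, ∫ ω, |B s ω| ^ p ∂P) =
          ∫ s in (0 : ℝ)..1,
            (2 * s * (1 - s)) ^ (p / 2) / √Real.pi * Real.Gamma ((1 + p) / 2)) ∧
    -- open boundary conditions, exponent 2
    (Tendsto (fun L : ℕ => (L : ℝ)⁻¹ *
          ((L : ℝ)⁻¹ * ∫ b, GridPoisson.criticalOpenCost 2 L b ∂(GridPoisson.blueLaw L L)))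
        atTop (𝓝 (1 / 6)) ∧
      (∫ s in (0 : ℝ)..1, s * (1 - s)) = 1 / 6) ∧
    -- periodic boundary conditions, exponent 2
    ((∀ L : ℕ, Integrable (GridPoisson.criticalPeriodicCost 2 L) (GridPoisson.blueLaw L L)) ∧
      Tendsto (fun L : ℕ => (L : ℝ)⁻¹ *
          ((L : ℝ)⁻¹ * ∫ b, GridPoisson.criticalPeriodicCost 2 L b ∂(GridPoisson.blueLaw L L)))
        atTop (𝓝 (1 / 12))) := by
  refine ⟨fun p hp => ?_, ⟨GridPoisson.tendsto_mean_criticalOpenCost_two, ?_⟩,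
    GridPoisson.integrable_criticalPeriodicCost two_pos.le,
    GridPoisson.tendsto_mean_criticalPeriodicCost⟩
  · have hp0 : 0 < p := by linarith
    refine ⟨GridPoisson.integrable_criticalOpenCost hp0.le,
      GridPoisson.tendsto_mean_criticalOpenCost hp.le, GridPoisson.integral_gaussian_moment hp0,
      GridPoisson.gaussian_moment_eq hp0, fun Ω _ P B hB => ?_⟩
    exact ⟨fun s => (hB.integral_abs_rpow hp0 s).1, hB.integral_integral_abs_rpow hp0⟩
  · simp only [mul_sub, mul_one]
    rw [intervalIntegral.integral_sub (Continuous.intervalIntegrable (by fun_prop) _ _)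
      (Continuous.intervalIntegrable (by fun_prop) _ _)]
    simp only [← sq]
    rw [integral_id, integral_pow]
    norm_num
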